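/- Let $p$ and $\ell$ be prime numbers (possibly equal) and let $k$ be a finite extension of $\mathbb{Q}_p$ with algebraic closure $\bar k$. For a finite extension $F$ of $\mathbb{Q}_p$ let $$\mathcal{R}_F=\varprojlim_n F^\times/F^{\times \ell^n},$$ and let $v_F:\mathcal{R}_F\to\mathbb{Z}_\ell=\varprojlim_n\mathbb{Z}/\ell^n\mathbb{Z}$ be the homomorphism induced by the normalized discrete valuation $F^\times\to\mathbb{Z}$, i.e. the exponent in $\mathbb{Z}_\ell$ of a uniformizer. For a finite extension $L/K$ of such fields let $N_{L/K}:\mathcal{R}_L\to\mathcal{R}_K$ be the norm. Let $\hat k\subset\bar k$ be the maximal pro-$\ell$-extension of $k$ (the compositum of the finite Galois extensions of $\ell$-power degree), $k^{nr}\subset\hat k$ the maximal unramified pro-$\ell$-extension (the compositum of the unramified ones among them), and $G=\mathrm{Gal}(\hat k/k)$. For an extension $L\subset\bar k$ of $k$ let $G_L\subset G$ be the subgroup of elements that fix $L\cap\hat k$ pointwise (so $G_L=\mathrm{Gal}(\hat k/L)$ if $L\subset\hat k$). There is a continuous surjective homomorphism $\deg:G\to\mathbb{Z}_\ell$ with kernel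 $G_{k^{nr}}$, that is, the composite of the restriction $G\to\mathrm{Gal}(k^{nr}/k)$ with an isomorphism $\mathrm{Gal}(k^{nr}/k)\simeq\mathbb{Z}_\ell$. For every such $\deg$, writing $f_{L/K}=(\deg G_K:\deg G_L)$ for finite extensions $k\subset K\subset L\subset \bar k$ and $f_L=(\mathbb{Z}_\ell:\deg G_L)$, the valuation $v_k$ is henselian with respect to $\deg$: its image $Z=v_k(\mathcal{R}_k)$ satisfies $\mathbb{Z}\subset Z$ and $Z/\ell^mZ\simeq\mathbb{Z}/\ell^m\mathbb{Z}$ for all $m\ge 0$, and $v_k(N_{L/k}\mathcal{R}_L)=f_L Z$ for every finite extension $L\subset\bar k$ of $k$. Moreover $Z=\mathbb{Z}_\ell$, and for all finite extensions $k\subset K\subset L\subset\bar k$ $$v_K(\mathcal{R}_K)=\mathbb{Z}_\ell,\qquad v_K(N_{L/K}\mathcal{R}_L)=f_{L/K}\,\mathbb{Z}_\ell .$$ -/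

import Mathlib

noncomputable section

namespace LAdicCFT

/-! ### `ℓ`-adification of an abelian group -/

section LAdification

variable (ℓ : ℕ)

/-- The projection `M / M ^ (ℓ ^ (n + 1)) → M / M ^ (ℓ ^ n)`. -/
def transition (M : Type*) [CommGroup M] (n : ℕ) :
    M ⧸ (powMonoidHom (ℓ ^ (n + 1)) : M →* M).range →*
      M ⧸ (powMonoidHom (ℓ ^ n) : M →* M).range :=
  QuotientGroup.map _ _ (MonoidHom.id M) (by
    rintro _ ⟨x, rfl⟩
    exact ⟨x ^ ℓ, by simp [← pow_mul, pow_succ, mul_comm]⟩)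

/-- The `ℓ`-adification `lim_n M / M ^ (ℓ ^ n)` of an abelian group `M`, written
multiplicatively, as the group of compatible families of classes. -/
def lAdification (M : Type*) [CommGroup M] :
    Subgroup (∀ n : ℕ, M ⧸ (powMonoidHom (ℓ ^ n) : M →* M).range) where
  carrier := {a | ∀ n, transition ℓ M n (a (n + 1)) = a n}
  one_mem' := fun n => map_one _
  mul_mem' := fun {a b} ha hb n => by
    rw [Pi.mul_apply, map_mul, ha n, hb n, Pi.mul_apply]
  inv_mem' := fun {a} ha n => by
    rw [Pi.inv_apply, map_inv, ha n, Pi.inv_apply]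

/-- The map `M / M ^ (ℓ ^ n) → N / N ^ (ℓ ^ n)` induced by a homomorphism `f : M → N`. -/
def levelMap {M N : Type*} [CommGroup M] [CommGroup N] (f : M →* N) (n : ℕ) :
    M ⧸ (powMonoidHom (ℓ ^ n) : M →* M).range →*
      N ⧸ (powMonoidHom (ℓ ^ n) : N →* N).range :=
  QuotientGroup.map _ _ f (by
    rintro _ ⟨x, rfl⟩
    exact ⟨f x, by simp⟩)

/-- Functoriality of the `ℓ`-adification. -/
def lAdificationMap {M N : Type*} [CommGroup M] [CommGroup N] (f : M →* N) :
    lAdification ℓ M →* lAdification ℓ N where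
  toFun a := ⟨fun n => levelMap ℓ f n (a.1 n), fun n => by
    obtain ⟨x, hx⟩ := QuotientGroup.mk_surjective (a.1 (n + 1))
    have h := a.2 n
    rw [← hx] at h
    show transition ℓ N n (levelMap ℓ f (n + 1) (a.1 (n + 1))) = levelMap ℓ f n (a.1 n)
    rw [← hx, ← h]
    rfl⟩
  map_one' := Subtype.ext (funext fun _ => map_one _)
  map_mul' _ _ := Subtype.ext (funext fun _ => map_mul _ _ _)

/-- The canonical homomorphism from `M` to its `ℓ`-adification. -/
def toLAdification (M : Type*) [CommGroup M] : M →* lAdification ℓ M where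
  toFun x := ⟨fun _ => QuotientGroup.mk x, fun _ => rfl⟩
  map_one' := rfl
  map_mul' _ _ := rfl

/-- An integer lifting the `n`-th component of an element of `lim_n ℤ / ℓ ^ n ℤ`. -/
def intLift (a : lAdification ℓ (Multiplicative ℤ)) (n : ℕ) : ℤ :=
  Multiplicative.toAdd (Quotient.out (a.1 n))

theorem mk_eq_mk_iff (n : ℕ) (x y : Multiplicative ℤ) :
    (QuotientGroup.mk x : Multiplicative ℤ ⧸
      (powMonoidHom (ℓ ^ n) : Multiplicative ℤ →* Multiplicative ℤ).range) =
        QuotientGroup.mk y ↔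
      ((ℓ : ℤ) ^ n) ∣ Multiplicative.toAdd y - Multiplicative.toAdd x := by
  rw [QuotientGroup.eq]
  constructor
  · rintro ⟨z, hz⟩
    refine ⟨Multiplicative.toAdd z, ?_⟩
    have := congrArg Multiplicative.toAdd hz
    simp at this
    linarith
  · rintro ⟨z, hz⟩
    refine ⟨Multiplicative.ofAdd z, ?_⟩
    apply Multiplicative.toAdd.injective
    simp
    linarith

theorem intLift_spec (a : lAdification ℓ (Multiplicative ℤ)) (n : ℕ) :
    QuotientGroup.mk (Multiplicative.ofAdd (intLift ℓ a n)) = a.1 n :=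
  Quotient.out_eq' (a.1 n)

theorem intLift_succ (a : lAdification ℓ (Multiplicative ℤ)) (n : ℕ) :
    (ℓ : ℤ) ^ n ∣ intLift ℓ a (n + 1) - intLift ℓ a n := by
  have h := a.2 n
  rw [← intLift_spec, ← intLift_spec] at h
  exact (mk_eq_mk_iff ℓ n _ _).1 h.symm

variable [Fact ℓ.Prime]

/-- The element of `ℤ_ℓ` attached to an element of `lim_n ℤ / ℓ ^ n ℤ`. -/
def padicIntOf (a : lAdification ℓ (Multiplicative ℤ)) : ℤ_[ℓ] :=
  PadicInt.ofIntSeq (intLift ℓ a)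
    (PadicInt.isCauSeq_padicNorm_of_pow_dvd_sub (intLift ℓ a) ℓ (intLift_succ ℓ a))


theorem toZModPow_padicIntOf (a : lAdification ℓ (Multiplicative ℤ)) (n : ℕ) (x : ℤ)
    (hx : QuotientGroup.mk (Multiplicative.ofAdd x) = a.1 n) :
    (padicIntOf ℓ a).toZModPow n = x := by
  rw [padicIntOf, PadicInt.toZModPow_ofIntSeq_of_pow_dvd_sub _ _ (intLift_succ ℓ a)]
  rw [← intLift_spec, mk_eq_mk_iff] at hx
  rw [eq_comm, ZMod.intCast_eq_intCast_iff_dvd_sub]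
  exact_mod_cast hx

theorem padicIntOf_mul (a b : lAdification ℓ (Multiplicative ℤ)) :
    padicIntOf ℓ (a * b) = padicIntOf ℓ a + padicIntOf ℓ b := by
  refine PadicInt.ext_of_toZModPow.1 fun n => ?_
  rw [map_add, toZModPow_padicIntOf ℓ a n _ (intLift_spec ℓ a n),
    toZModPow_padicIntOf ℓ b n _ (intLift_spec ℓ b n),
    toZModPow_padicIntOf ℓ (a * b) n (intLift ℓ a n + intLift ℓ b n), Int.cast_add]
  rw [ofAdd_add, QuotientGroup.mk_mul, intLift_spec, intLift_spec]
  rfl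

/-- The canonical identification of the `ℓ`-adification of `ℤ` with `ℤ_ℓ`
(`ℤ` and `ℤ_ℓ` are written multiplicatively). -/
def lAdificationInt : lAdification ℓ (Multiplicative ℤ) →* Multiplicative ℤ_[ℓ] :=
  MonoidHom.mk' (fun a => Multiplicative.ofAdd (padicIntOf ℓ a)) fun a b => by
    rw [padicIntOf_mul, ofAdd_add]

theorem lAdificationInt_toLAdification (x : Multiplicative ℤ) :
    lAdificationInt ℓ (toLAdification ℓ _ x) =
      Multiplicative.ofAdd ((Multiplicative.toAdd x : ℤ) : ℤ_[ℓ]) := by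
  refine congrArg Multiplicative.ofAdd (PadicInt.ext_of_toZModPow.1 fun n => ?_)
  rw [toZModPow_padicIntOf ℓ _ n (Multiplicative.toAdd x) rfl, map_intCast]

end LAdification

/-! ### The valuation of a finite extension of `ℚ_p` -/

section LocalField

variable (p : ℕ) [Fact p.Prime] (F : Type*) [Field F] [Algebra ℚ_[p] F]

/-- The ring of integers of an algebraic extension `F` of `ℚ_p`: the closed unit ball for the
unique extension to `F` of the `p`-adic absolute value. -/
def ringOfIntegers [Algebra.IsAlgebraic ℚ_[p] F] : ValuationSubring F where
  carrier := {x | spectralNorm ℚ_[p] F x ≤ 1}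
  mul_mem' := fun {x y} hx hy => by
    have h := map_mul (spectralMulAlgNorm (K := ℚ_[p]) (L := F)) x y
    simp only [spectralMulAlgNorm_def] at h
    simp only [Set.mem_ofPred_eq] at hx hy ⊢
    rw [h]
    exact mul_le_one₀ hx (spectralNorm_nonneg _) hy
  one_mem' := by simp [spectralNorm_one]
  add_mem' := fun {x y} hx hy =>
    (isNonarchimedean_spectralNorm (K := ℚ_[p]) (L := F) x y).trans (max_le hx hy)
  zero_mem' := by simp [spectralNorm_zero]
  neg_mem' := fun {x} hx => by
    simp only [Set.mem_ofPred_eq] at hx ⊢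
    rwa [spectralNorm_neg (Algebra.IsAlgebraic.isAlgebraic x)]
  mem_or_inv_mem' := fun x => by
    by_cases hx0 : x = 0
    · left
      simp [hx0, spectralNorm_zero]
    have h := map_mul (spectralMulAlgNorm (K := ℚ_[p]) (L := F)) x x⁻¹
    simp only [spectralMulAlgNorm_def, mul_inv_cancel₀ hx0, spectralNorm_one] at h
    rcases le_or_gt (spectralNorm ℚ_[p] F x) 1 with h1 | h1
    · exact Or.inl h1
    · right
      show spectralNorm ℚ_[p] F x⁻¹ ≤ 1
      by_contra h2
      push Not at h2
      nlinarith

instance [FiniteDimensional ℚ_[p] F] : IsDiscreteValuationRing (ringOfIntegers p F) := by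
  let : NontriviallyNormedField F := spectralNorm.nontriviallyNormedField ℚ_[p] F
  let : NormedSpace ℚ_[p] F := spectralNorm.normedSpace ℚ_[p] F
  have : ProperSpace F := FiniteDimensional.proper ℚ_[p] F
  have : IsUltrametricDist F :=
    IsUltrametricDist.isUltrametricDist_of_isNonarchimedean_norm
      (isNonarchimedean_spectralNorm (K := ℚ_[p]) (L := F))
  let : Valued F NNReal := NormedField.toValued
  have hmem : ∀ x : F, x ∈ (Valued.v : Valuation F NNReal).integer ↔ ‖x‖ ≤ 1 :=
    fun x => Valued.integer.mem_iff
  have : CompactSpace (Valued.v : Valuation F NNReal).integer := by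
    have : ((Valued.v : Valuation F NNReal).integer : Set F) = Metric.closedBall 0 1 := by
      ext x
      rw [SetLike.mem_coe, hmem, mem_closedBall_zero_iff]
    refine isCompact_iff_compactSpace.1 ?_
    show IsCompact ((Valued.v : Valuation F NNReal).integer : Set F)
    rw [this]
    exact isCompact_closedBall 0 1
  have : (Valued.v : Valuation F NNReal).IsNontrivial := by
    obtain ⟨x, hx0, hx1⟩ := NormedField.exists_norm_lt_one F
    refine Valuation.IsNontrivial.mk ⟨x, ?_, ?_⟩
    · rw [Valuation.ne_zero_iff]
      exact norm_pos_iff.1 hx0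
    · intro h
      have h1 : ‖x‖ = 1 := congrArg NNReal.toReal h
      linarith
  have : IsDiscreteValuationRing (Valued.v : Valuation F NNReal).integer :=
    Valued.integer.isDiscreteValuationRing_of_compactSpace
  let e : (Valued.v : Valuation F NNReal).integer ≃+* ringOfIntegers p F :=
    { toFun := fun x => ⟨x.1, (hmem x.1).1 x.2⟩
      invFun := fun x => ⟨x.1, (hmem x.1).2 x.2⟩
      left_inv := fun _ => rfl
      right_inv := fun _ => rfl
      map_mul' := fun _ _ => rfl
      map_add' := fun _ _ => rfl }
  exact IsDiscreteValuationRing.RingEquivClass.isDiscreteValuationRing e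

/-- The normalised (surjective) discrete valuation `w` of a finite extension `F` of `ℚ_p`, on
`Fˣ` and with values in `ℤ` written multiplicatively. The inverse is there because
`valuationOfNeZero` sends a uniformizer to `-1`. -/
def normalizedVal [FiniteDimensional ℚ_[p] F] : Fˣ →* Multiplicative ℤ :=
  ((IsDiscreteValuationRing.maximalIdeal (ringOfIntegers p F)).valuationOfNeZero (K := F))⁻¹

theorem normalizedVal_of_irreducible [FiniteDimensional ℚ_[p] F] (π : ringOfIntegers p F)
    (hπ : Irreducible π) (x : Fˣ) (hx : (x : F) = π) :
    normalizedVal p F x = Multiplicative.ofAdd 1 := by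
  have h : (IsDiscreteValuationRing.maximalIdeal (ringOfIntegers p F)).valuation F x =
      (Multiplicative.ofAdd (-1 : ℤ) : Multiplicative ℤ) := by
    rw [hx]
    refine ((IsDiscreteValuationRing.maximalIdeal
      (ringOfIntegers p F)).valuation_of_algebraMap π).trans ?_
    exact IsDedekindDomain.HeightOneSpectrum.intValuation_singleton _ hπ.ne_zero
      (IsDiscreteValuationRing.irreducible_iff_uniformizer π |>.1 hπ)
  rw [← IsDedekindDomain.HeightOneSpectrum.valuationOfNeZero_eq, WithZero.coe_inj] at h
  rw [normalizedVal, MonoidHom.inv_apply, h]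
  rfl

variable (ℓ : ℕ) [Fact ℓ.Prime]

/-- The `ℓ`-adic valuation `v` on the `ℓ`-adification of `Fˣ`, induced by the normalised valuation
of `F`: the exponent in `ℤ_ℓ` of a uniformizer. Values in `ℤ_ℓ` are written multiplicatively. -/
def lAdicVal [FiniteDimensional ℚ_[p] F] : lAdification ℓ Fˣ →* Multiplicative ℤ_[ℓ] :=
  (lAdificationInt ℓ).comp (lAdificationMap ℓ (normalizedVal p F))

theorem lAdicVal_toLAdification [FiniteDimensional ℚ_[p] F] (x : Fˣ) :
    lAdicVal p F ℓ (toLAdification ℓ Fˣ x) =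
      Multiplicative.ofAdd ((Multiplicative.toAdd (normalizedVal p F x) : ℤ) : ℤ_[ℓ]) :=
  lAdificationInt_toLAdification ℓ (normalizedVal p F x)

end LocalField

/-! ### The norm -/

section Norm

variable (ℓ : ℕ)

/-- The norm from the `ℓ`-adification of `Lˣ` to that of `Kˣ`, for an extension of fields `L/K`. -/
def lAdicNorm (K L : Type*) [Field K] [Field L] [Algebra K L] :
    lAdification ℓ Lˣ →* lAdification ℓ Kˣ :=
  lAdificationMap ℓ (Units.map (Algebra.norm K : L →* K))

/-- In the `ℓ`-adification of `Mˣ`, for `M/K` normal and containing `L`, the norm is the product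
of the conjugates. -/
theorem lAdicNorm_eq_prod (K L M : Type*) [Field K] [Field L] [Field M] [Algebra K L]
    [Algebra K M] [Algebra L M] [IsScalarTower K L M] [FiniteDimensional K L]
    [Algebra.IsSeparable K L] [Normal K M] (a : lAdification ℓ Lˣ) :
    lAdificationMap ℓ (Units.map (algebraMap K M : K →* M)) (lAdicNorm ℓ K L a) =
      ∏ σ : L →ₐ[K] M, lAdificationMap ℓ (Units.map (σ : L →* M)) a := by
  have key : ∀ x : Lˣ, Units.map (algebraMap K M : K →* M)
      (Units.map (Algebra.norm K : L →* K) x) = ∏ σ : L →ₐ[K] M, Units.map (σ : L →* M) x := by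
    intro x
    let e : (L →ₐ[K] M) ≃ (L →ₐ[K] AlgebraicClosure M) :=
      Algebra.IsAlgebraic.algHomEquivAlgHomOfSplits (AlgebraicClosure M) M fun y => by
        rw [← minpoly.algebraMap_eq (algebraMap L M).injective y]
        exact Normal.splits inferInstance (algebraMap L M y)
    apply Units.ext
    apply (algebraMap M (AlgebraicClosure M)).injective
    have h := Algebra.norm_eq_prod_embeddings K (AlgebraicClosure M) (x : L)
    rw [← e.prod_comp] at h
    simp only [Units.coe_map, Units.coe_prod, map_prod]
    rw [MonoidHom.coe_coe, ← IsScalarTower.algebraMap_apply]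
    exact h
  refine Subtype.ext (funext fun n => ?_)
  obtain ⟨x, hx⟩ := QuotientGroup.mk_surjective (a.1 n)
  rw [Subgroup.val_finsetProd, Finset.prod_apply]
  have h1 : ∀ σ : L →ₐ[K] M, (lAdificationMap ℓ (Units.map (σ : L →* M)) a).1 n =
      QuotientGroup.mk (Units.map (σ : L →* M) x) := by
    intro σ
    show levelMap ℓ _ n (a.1 n) = _
    rw [← hx]
    rfl
  simp only [h1]
  show levelMap ℓ _ n (levelMap ℓ _ n (a.1 n)) = _
  rw [← hx]
  refine (congrArg QuotientGroup.mk (key x)).trans ?_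
  exact map_prod (QuotientGroup.mk' _) _ _

end Norm

/-! ### The Galois group, the degree map and henselian valuations -/

section Galois

variable (p ℓ : ℕ) [Fact p.Prime] [Fact ℓ.Prime]
variable (k : Type*) [Field k]

/-- Finite Galois extensions of `ℓ`-power degree, inside an algebraic closure of `k`. -/
def IsLExtension (E : IntermediateField k (AlgebraicClosure k)) : Prop :=
  FiniteDimensional k E ∧ IsGalois k E ∧ ∃ n : ℕ, Module.finrank k E = ℓ ^ n

/-- The maximal pro-`ℓ`-extension of `k`: the compositum of the `ℓ`-extensions of `k`. -/
def maxProL : IntermediateField k (AlgebraicClosure k) :=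
  sSup {E | IsLExtension ℓ k E}

/-- The Galois group `G` of the maximal pro-`ℓ`-extension of `k`. -/
abbrev proLGaloisGroup : Type _ := maxProL ℓ k ≃ₐ[k] maxProL ℓ k

/-- The subgroup `G_L` of `G` attached to an algebraic extension `L` of `k`: the elements of `G`
that are the identity on the elements of the maximal pro-`ℓ`-extension lying in `L`. -/
def galSubgroup (L : IntermediateField k (AlgebraicClosure k)) :
    Subgroup (proLGaloisGroup ℓ k) :=
  (L.comap (maxProL ℓ k).val).fixingSubgroup

variable [Algebra ℚ_[p] k] [FiniteDimensional ℚ_[p] k]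

theorem finiteDimensional_padic (E : IntermediateField k (AlgebraicClosure k))
    [FiniteDimensional k E] : FiniteDimensional ℚ_[p] E :=
  FiniteDimensional.trans ℚ_[p] k E

/-- A finite extension `E` of `k` is unramified if its ramification index is `1`, that is, if the
normalised valuation of `E` extends that of `k`. -/
def IsUnramified (E : IntermediateField k (AlgebraicClosure k)) [FiniteDimensional k E] : Prop :=
  haveI := finiteDimensional_padic p k E
  ∀ x : kˣ, normalizedVal p E (Units.map (algebraMap k E : k →* E) x) = normalizedVal p k x

/-- The maximal unramified pro-`ℓ`-extension of `k`: the compositum of the unramified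
`ℓ`-extensions of `k`. -/
def maxUnramifiedProL : IntermediateField k (AlgebraicClosure k) :=
  sSup {E | IsLExtension ℓ k E ∧ ∃ _ : FiniteDimensional k E, IsUnramified p k E}

/-- A degree map on `G`: a continuous surjective homomorphism `deg : G → ℤ_ℓ` whose kernel is the
subgroup of `G` fixing the maximal unramified pro-`ℓ`-extension `k^nr` of `k`. These are the
composites of the restriction `G → Gal(k^nr/k)` with an isomorphism `Gal(k^nr/k) ≃ ℤ_ℓ`. -/
structure IsDegreeMap (deg : proLGaloisGroup ℓ k →ₜ* Multiplicative ℤ_[ℓ]) : Prop where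
  surjective : Function.Surjective deg
  ker_eq : deg.toMonoidHom.ker = galSubgroup ℓ k (maxUnramifiedProL p ℓ k)

variable {ℓ k}

/-- The inertia degree `f_{L/K} = (deg G_K : deg G_L)`. -/
def inertiaDegree (deg : proLGaloisGroup ℓ k →ₜ* Multiplicative ℤ_[ℓ])
    (K L : IntermediateField k (AlgebraicClosure k)) : ℕ :=
  ((galSubgroup ℓ k L).map deg.toMonoidHom).relIndex ((galSubgroup ℓ k K).map deg.toMonoidHom)

/-- A homomorphism `v` from the `ℓ`-adification of `kˣ` to `ℤ_ℓ` is henselian with respect to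
`deg : G → ℤ_ℓ` if its image `Z` contains `ℤ` and satisfies `Z / ℓ ^ m Z ≃ ℤ / ℓ ^ m ℤ` for all
`m`, and if `v (N_{L/k} A_L) = f_L Z` for all finite extensions `L` of `k`, where
`f_L = (ℤ_ℓ : deg G_L)` and `A_L` is the `ℓ`-adification of `Lˣ`. The groups `Z` and `ℤ_ℓ` are
written multiplicatively, so that `n Z` is the image of the `n`-th power map. -/
structure IsHenselianValuation (deg : proLGaloisGroup ℓ k →ₜ* Multiplicative ℤ_[ℓ])
    (v : lAdification ℓ kˣ →* Multiplicative ℤ_[ℓ]) : Prop where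
  int_mem : ∀ n : ℤ, Multiplicative.ofAdd (n : ℤ_[ℓ]) ∈ v.range
  quotient : ∀ m : ℕ, Nonempty
    ((v.range ⧸ (powMonoidHom (ℓ ^ m) : v.range →* v.range).range) ≃*
      Multiplicative (ZMod (ℓ ^ m)))
  range_norm : ∀ L : IntermediateField k (AlgebraicClosure k), FiniteDimensional k L →
    (v.comp (lAdicNorm ℓ k L)).range =
      v.range.map (powMonoidHom ((galSubgroup ℓ k L).map deg.toMonoidHom).index)

end Galois

end LAdicCFT
end

noncomputable section

namespace LAdicCFT

/-! Everything reduces to comparing two inertia degrees. On the field side, let `f` be the classical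
residue degree of `L/K`. The norm of a unit is a unit and the norm of a uniformizer has valuation
`f`, so `normalizedVal_norm` and its ℓ-adic form `lAdicVal_lAdicNorm` show that the norm multiplies
valuations by `f`. Since `v_L` maps onto `ℤ_ℓ`, the image of the norms is `f ℤ_ℓ`. The prime-to-`ℓ`
part of `f` is a unit of `ℤ_ℓ`, so only the `ℓ`-part of `f` matters (`range_powMonoidHom_eq`).

On the Galois side, `ker deg = G_{k^nr}`, hence `deg G_L` has index `(G : G_L G_{k^nr}) = [L ∩ k^nr
: k]`. The unramified extension of degree `m` is generated by the roots of unity of order dividing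
`q ^ m - 1`, and it lies in `L` when `m` divides the residue degree of `L/k`. So `L ∩ k^nr` has
degree the exact power of `ℓ` dividing that residue degree (`finrank_inf_maxUnramifiedProL`). The
two sides agree over `k`, and over an intermediate `K` by multiplicativity.

A degree map exists because each automorphism acts on these roots of unity by a power of Frobenius.
For `m = ℓ ^ n` the exponent is well defined modulo `ℓ ^ n`, and the exponents assemble to an
element of `ℤ_ℓ`. -/

theorem charZero_padic_algebra (p : ℕ) [Fact p.Prime] (F : Type*) [Field F] [Algebra ℚ_[p] F] :
    CharZero F :=
  charZero_of_injective_algebraMap (algebraMap ℚ_[p] F).injective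

/-! ### Rings of integers, residue fields and the norm of the maximal ideal -/

section LocalExtension

open IsLocalRing

variable (p : ℕ) [Fact p.Prime] (F E : Type*) [Field F] [Field E] [Algebra ℚ_[p] F]
  [Algebra ℚ_[p] E] [Algebra F E] [IsScalarTower ℚ_[p] F E]

theorem mem_ringOfIntegers [Algebra.IsAlgebraic ℚ_[p] F] (x : F) :
    x ∈ ringOfIntegers p F ↔ spectralNorm ℚ_[p] F x ≤ 1 := Iff.rfl

/-- The inclusion of rings of integers. -/
abbrev integersAlgebra [Algebra.IsAlgebraic ℚ_[p] F] [Algebra.IsAlgebraic ℚ_[p] E] :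
    Algebra (ringOfIntegers p F) (ringOfIntegers p E) :=
  RingHom.toAlgebra <| ((algebraMap F E).comp (ringOfIntegers p F).subtype).codRestrict
    (ringOfIntegers p E).toSubring fun x => by
      show spectralNorm ℚ_[p] E (algebraMap F E x) ≤ 1
      rw [← spectralNorm.eq_of_tower]
      exact x.2

attribute [local instance] integersAlgebra

section

variable [Algebra.IsAlgebraic ℚ_[p] F] [Algebra.IsAlgebraic ℚ_[p] E]

/-- `ℤ_p` as a subring of the ring of integers of an extension. -/
def padicIntToIntegers : ℤ_[p] →+* ringOfIntegers p F :=
  ((algebraMap ℚ_[p] F).comp PadicInt.Coe.ringHom).codRestrict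
    (ringOfIntegers p F).toSubring fun x => by
      show spectralNorm ℚ_[p] F (algebraMap ℚ_[p] F x) ≤ 1
      rw [spectralNorm_extends]
      exact x.2

/-- The spectral norm is read off from the coefficients of the minimal polynomial over `ℚ_p`; it is
at most `1` exactly when all of them lie in `ℤ_p`. -/
theorem exists_monic_padicInt {x : F} (hx : x ∈ ringOfIntegers p F) :
    ∃ P : Polynomial ℤ_[p], P.Monic ∧
      P.eval₂ ((algebraMap ℚ_[p] F).comp PadicInt.Coe.ringHom) x = 0 := by
  have hi : IsIntegral ℚ_[p] x := Algebra.IsIntegral.isIntegral x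
  have hm := minpoly.monic hi
  have hc := (spectralValue_le_one_iff hm).1 ((mem_ringOfIntegers p F x).1 hx)
  have hl : minpoly ℚ_[p] x ∈ Polynomial.lifts PadicInt.Coe.ringHom := by
    rw [Polynomial.lifts_iff_coeff_lifts]
    exact fun n => ⟨⟨_, hc n⟩, rfl⟩
  obtain ⟨P, hP, -, hPm⟩ := Polynomial.lifts_and_degree_eq_and_monic hl hm
  refine ⟨P, hPm, ?_⟩
  rw [← Polynomial.eval₂_map, hP]
  exact minpoly.aeval _ _

theorem padicIntToIntegers_isIntegral : (padicIntToIntegers p F).IsIntegral := by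
  intro x
  obtain ⟨P, hP, h⟩ := exists_monic_padicInt p F x.2
  refine ⟨P, hP, Subtype.ext ?_⟩
  exact Eq.trans (Polynomial.hom_eval₂ P (padicIntToIntegers p F) (ringOfIntegers p F).subtype x) h

theorem algebraMap_comp_padicIntToIntegers :
    (algebraMap (ringOfIntegers p F) (ringOfIntegers p E)).comp (padicIntToIntegers p F) =
      padicIntToIntegers p E := by
  ext x
  show algebraMap F E (algebraMap ℚ_[p] F x) = algebraMap ℚ_[p] E x
  rw [← IsScalarTower.algebraMap_apply]

instance integers_isIntegral :
    Algebra.IsIntegral (ringOfIntegers p F) (ringOfIntegers p E) := by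
  have h := padicIntToIntegers_isIntegral p E
  rw [← algebraMap_comp_padicIntToIntegers p F E] at h
  exact ⟨RingHom.IsIntegral.tower_top _ _ h⟩

instance integers_isScalarTower :
    IsScalarTower (ringOfIntegers p F) (ringOfIntegers p E) E :=
  IsScalarTower.of_algebraMap_eq fun _ => rfl

instance integers_isIntegralClosure :
    IsIntegralClosure (ringOfIntegers p E) (ringOfIntegers p F) E :=
  IsIntegralClosure.of_isIntegrallyClosed _ _ _

instance integers_faithful : FaithfulSMul (ringOfIntegers p F) (ringOfIntegers p E) :=
  (faithfulSMul_iff_algebraMap_injective _ _).2 fun _ _ h => Subtype.ext <|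
    (algebraMap F E).injective (congrArg Subtype.val h)

end

variable [FiniteDimensional ℚ_[p] F] [FiniteDimensional ℚ_[p] E]

instance integers_finite : Module.Finite (ringOfIntegers p F) (ringOfIntegers p E) := by
  have := charZero_padic_algebra p F
  have : FiniteDimensional F E := FiniteDimensional.right ℚ_[p] F E
  exact IsIntegralClosure.finite (ringOfIntegers p F) F E (ringOfIntegers p E)

/-- The cardinality of the residue field. -/
def residueCard : ℕ := Nat.card (ResidueField (ringOfIntegers p F))

/-- The ring of integers is the integral closure of `ℤ_p` in `F`, hence a finite `ℤ_p`-module, so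
its residue field is finite over that of `ℤ_p`. -/
instance finite_residueField : Finite (ResidueField (ringOfIntegers p F)) := by
  let := (padicIntToIntegers p F).toAlgebra
  let : Algebra ℤ_[p] F := ((algebraMap ℚ_[p] F).comp PadicInt.Coe.ringHom).toAlgebra
  have : IsScalarTower ℤ_[p] ℚ_[p] F := IsScalarTower.of_algebraMap_eq fun _ => rfl
  have : IsScalarTower ℤ_[p] (ringOfIntegers p F) F := IsScalarTower.of_algebraMap_eq fun _ => rfl
  have : Algebra.IsIntegral ℤ_[p] (ringOfIntegers p F) := ⟨padicIntToIntegers_isIntegral p F⟩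
  have : IsIntegralClosure (ringOfIntegers p F) ℤ_[p] F :=
    IsIntegralClosure.of_isIntegrallyClosed _ _ _
  have : Module.Finite ℤ_[p] (ringOfIntegers p F) :=
    IsIntegralClosure.finite ℤ_[p] ℚ_[p] F (ringOfIntegers p F)
  have : FaithfulSMul ℤ_[p] (ringOfIntegers p F) :=
    (faithfulSMul_iff_algebraMap_injective _ _).2 fun x y h => Subtype.ext <|
      (algebraMap ℚ_[p] F).injective (congrArg Subtype.val h)
  have : IsLocalHom (algebraMap ℤ_[p] (ringOfIntegers p F)) := inferInstance
  have : Finite (ResidueField ℤ_[p]) := inferInstance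
  exact Module.finite_of_finite (ResidueField ℤ_[p])

theorem one_lt_residueCard : 1 < residueCard p F := Finite.one_lt_card

instance integers_isLocalHom :
    IsLocalHom (algebraMap (ringOfIntegers p F) (ringOfIntegers p E)) := inferInstance

/-- The residue degree of an extension of `p`-adic fields. -/
def residueDegree : ℕ :=
  Module.finrank (ResidueField (ringOfIntegers p F)) (ResidueField (ringOfIntegers p E))

theorem residueCard_eq_pow : residueCard p E = residueCard p F ^ residueDegree p F E :=
  Module.natCard_eq_pow_finrank

theorem residueDegree_pos : 0 < residueDegree p F E := Module.finrank_pos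

theorem residueDegree_eq_of_residueCard {f : ℕ} (h : residueCard p E = residueCard p F ^ f) :
    residueDegree p F E = f :=
  Nat.pow_right_injective (one_lt_residueCard p F) ((residueCard_eq_pow p F E).symm.trans h)

theorem relNorm_maximalIdeal :
    Ideal.relNorm (ringOfIntegers p F) (maximalIdeal (ringOfIntegers p E)) =
      maximalIdeal (ringOfIntegers p F) ^ residueDegree p F E := by
  have := charZero_padic_algebra p F
  have : CharZero (FractionRing (ringOfIntegers p F)) := inferInstance
  rw [Ideal.relNorm_eq_pow_of_isMaximal (maximalIdeal (ringOfIntegers p E))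
    (maximalIdeal (ringOfIntegers p F)), Ideal.inertiaDeg_eq_of_isMaximal
    (maximalIdeal (ringOfIntegers p F))]
  rfl

end LocalExtension

/-! ### Valuation of a norm, and the criterion for being unramified -/

section NormValuation

open IsLocalRing

variable (p : ℕ) [Fact p.Prime] (F E : Type*) [Field F] [Field E] [Algebra ℚ_[p] F]
  [Algebra ℚ_[p] E] [Algebra F E] [IsScalarTower ℚ_[p] F E]
  [FiniteDimensional ℚ_[p] F] [FiniteDimensional ℚ_[p] E]

theorem normalizedVal_unit (u : (ringOfIntegers p F)ˣ) :
    normalizedVal p F (Units.map (algebraMap (ringOfIntegers p F) F : _ →* F) u) = 1 := by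
  rw [normalizedVal, MonoidHom.inv_apply, inv_eq_one]
  exact IsDedekindDomain.HeightOneSpectrum.valuation_of_unit_eq _ u

theorem normalizedVal_surjective : Function.Surjective (normalizedVal p F) := by
  obtain ⟨π, hπ⟩ := IsDiscreteValuationRing.exists_irreducible (ringOfIntegers p F)
  have hπ0 : (π : F) ≠ 0 := fun h => hπ.ne_zero (Subtype.ext h)
  intro n
  refine ⟨Units.mk0 (π : F) hπ0 ^ (Multiplicative.toAdd n), ?_⟩
  rw [map_zpow, normalizedVal_of_irreducible p F π hπ _ rfl, ← ofAdd_zsmul, smul_eq_mul, mul_one,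
    ofAdd_toAdd]

-- Units and uniformizers generate `Fˣ`: an integer is a unit times a power of a uniformizer, and
-- every element or its inverse is an integer.
variable {p F} in
theorem monoidHom_ext_integers {A : Type*} [Group A] {φ ψ : Fˣ →* A}
    (hu : ∀ u : (ringOfIntegers p F)ˣ,
      φ (Units.map (algebraMap (ringOfIntegers p F) F : _ →* F) u) =
        ψ (Units.map (algebraMap (ringOfIntegers p F) F : _ →* F) u))
    (hπ : ∀ π : ringOfIntegers p F, Irreducible π → ∀ x : Fˣ, (x : F) = π → φ x = ψ x) :
    φ = ψ := by
  obtain ⟨π, hirr⟩ := IsDiscreteValuationRing.exists_irreducible (ringOfIntegers p F)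
  have hπ0 : (π : F) ≠ 0 := fun h => hirr.ne_zero (Subtype.ext h)
  have key : ∀ x : Fˣ, (x : F) ∈ ringOfIntegers p F → φ x = ψ x := by
    intro x hx
    have hx0 : (⟨x, hx⟩ : ringOfIntegers p F) ≠ 0 := fun h => x.ne_zero (congrArg Subtype.val h)
    obtain ⟨n, u, h⟩ := IsDiscreteValuationRing.eq_unit_mul_pow_irreducible hx0 hirr
    have hx' : x = Units.map (algebraMap (ringOfIntegers p F) F : _ →* F) u *
        Units.mk0 (π : F) hπ0 ^ n := Units.ext (by
      rw [Units.val_mul, Units.val_pow_eq_pow_val]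
      exact congrArg Subtype.val h)
    rw [hx', map_mul, map_mul, map_pow, map_pow, hu, hπ π hirr _ rfl]
  ext x
  rcases (ringOfIntegers p F).mem_or_inv_mem (x : F) with h | h
  · exact key x h
  · rw [← inv_inj, ← map_inv, ← map_inv]
    exact key x⁻¹ (by rwa [Units.val_inv_eq_inv_val])

attribute [local instance] integersAlgebra

theorem coe_intNorm (x : ringOfIntegers p E) :
    ((Algebra.intNorm (ringOfIntegers p F) (ringOfIntegers p E) x : ringOfIntegers p F) : F) =
      Algebra.norm F (x : E) := by
  have : FiniteDimensional F E := FiniteDimensional.right ℚ_[p] F E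
  exact Algebra.algebraMap_intNorm (A := ringOfIntegers p F) (K := F) (L := E) x

/-- Compare on generators. Norms of units are units, and the norm of a uniformizer generates the
relative norm of the maximal ideal, which is the power of the lower maximal ideal with exponent the
residue degree. -/
theorem normalizedVal_norm (x : Eˣ) :
    normalizedVal p F (Units.map (Algebra.norm F : E →* F) x) =
      normalizedVal p E x ^ residueDegree p F E := by
  suffices h : (normalizedVal p F).comp (Units.map (Algebra.norm F : E →* F)) =
      (powMonoidHom (residueDegree p F E)).comp (normalizedVal p E) from DFunLike.congr_fun h x
  refine monoidHom_ext_integers (p := p) (fun u => ?_) fun π hπ x hx => ?_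
  · rw [MonoidHom.comp_apply, MonoidHom.comp_apply, normalizedVal_unit, map_one]
    rw [← normalizedVal_unit p F (Units.map
      (Algebra.intNorm (ringOfIntegers p F) (ringOfIntegers p E) : _ →* _) u)]
    congr 1
    exact Units.ext (coe_intNorm p F E u).symm
  · obtain ⟨ϖ, hϖ⟩ := IsDiscreteValuationRing.exists_irreducible (ringOfIntegers p F)
    have hϖ0 : (ϖ : F) ≠ 0 := fun h => hϖ.ne_zero (Subtype.ext h)
    have h := relNorm_maximalIdeal p F E
    rw [hπ.maximalIdeal_eq, hϖ.maximalIdeal_eq, Ideal.relNorm_singleton,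
      Ideal.span_singleton_pow, Ideal.span_singleton_eq_span_singleton] at h
    obtain ⟨u, hu⟩ := h.symm
    have hx' : Units.map (Algebra.norm F : E →* F) x =
        Units.mk0 (ϖ : F) hϖ0 ^ residueDegree p F E *
          Units.map (algebraMap (ringOfIntegers p F) F : _ →* F) u := Units.ext (by
      rw [Units.val_mul, Units.val_pow_eq_pow_val, Units.coe_map, hx]
      exact (coe_intNorm p F E π).symm.trans (congrArg Subtype.val hu.symm))
    rw [MonoidHom.comp_apply, MonoidHom.comp_apply, hx', map_mul, normalizedVal_unit, mul_one,
      map_pow, normalizedVal_of_irreducible p F ϖ hϖ _ rfl, normalizedVal_of_irreducible p E π hπ x hx]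
    rfl

/-- This is `e f = n`, obtained without introducing `e`, from the fact that the norm of an element
of the base is its `n`-th power. -/
theorem normalizedVal_pow_finrank (x : Fˣ) :
    normalizedVal p E (Units.map (algebraMap F E : F →* E) x) ^ residueDegree p F E =
      normalizedVal p F x ^ Module.finrank F E := by
  rw [← normalizedVal_norm, ← map_pow]
  congr 1
  exact Units.ext (Algebra.norm_algebraMap _)

theorem residueDegree_dvd_finrank : residueDegree p F E ∣ Module.finrank F E := by
  obtain ⟨x, hx⟩ := normalizedVal_surjective p F (Multiplicative.ofAdd 1)
  have h := congrArg Multiplicative.toAdd (normalizedVal_pow_finrank p F E x)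
  rw [hx, toAdd_pow, toAdd_pow, toAdd_ofAdd] at h
  exact Int.natCast_dvd_natCast.1 ⟨_, by simpa using h.symm⟩

theorem forall_normalizedVal_eq_iff :
    (∀ x : Fˣ, normalizedVal p E (Units.map (algebraMap F E : F →* E) x) = normalizedVal p F x) ↔
      residueDegree p F E = Module.finrank F E := by
  constructor
  · intro h
    obtain ⟨x, hx⟩ := normalizedVal_surjective p F (Multiplicative.ofAdd 1)
    have h' := congrArg Multiplicative.toAdd (normalizedVal_pow_finrank p F E x)
    rw [h, hx, toAdd_pow, toAdd_pow, toAdd_ofAdd] at h'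
    simpa using h'
  · intro h x
    have h' := normalizedVal_pow_finrank p F E x
    rw [← h] at h'
    exact pow_left_injective (residueDegree_pos p F E).ne' h'

theorem residueDegree_mul (M : Type*) [Field M] [Algebra ℚ_[p] M] [FiniteDimensional ℚ_[p] M]
    [Algebra F M] [Algebra E M] [IsScalarTower ℚ_[p] F M] [IsScalarTower ℚ_[p] E M] :
    residueDegree p F E * residueDegree p E M = residueDegree p F M := by
  symm
  apply residueDegree_eq_of_residueCard
  rw [pow_mul, ← residueCard_eq_pow, ← residueCard_eq_pow]

end NormValuation

/-! ### Teichmüller lifts and the Galois action on roots of unity -/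

section RootsOfUnity

open IsLocalRing

variable (p : ℕ) [Fact p.Prime] (F : Type*) [Field F] [Algebra ℚ_[p] F]
  [FiniteDimensional ℚ_[p] F]

theorem spectralNorm_mul_of_isAlgebraic (x y : F) :
    spectralNorm ℚ_[p] F (x * y) = spectralNorm ℚ_[p] F x * spectralNorm ℚ_[p] F y :=
  map_mul (spectralMulAlgNorm (K := ℚ_[p]) (L := F)) x y

theorem spectralNorm_pow_of_isAlgebraic (x : F) (n : ℕ) :
    spectralNorm ℚ_[p] F (x ^ n) = spectralNorm ℚ_[p] F x ^ n :=
  map_pow (spectralMulAlgNorm (K := ℚ_[p]) (L := F)) x n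

theorem mem_maximalIdeal_integers_iff (x : ringOfIntegers p F) :
    x ∈ maximalIdeal (ringOfIntegers p F) ↔ spectralNorm ℚ_[p] F x < 1 := by
  rw [mem_maximalIdeal, mem_nonunits_iff]
  constructor
  · intro h
    refine lt_of_le_of_ne x.2 fun h1 => h ?_
    have hx0 : (x : F) ≠ 0 := fun h0 => by simp [h0, spectralNorm_zero] at h1
    have hi : (x : F)⁻¹ ∈ ringOfIntegers p F := by
      have h2 := spectralNorm_mul_of_isAlgebraic p F x (x : F)⁻¹
      rw [mul_inv_cancel₀ hx0, spectralNorm_one, h1, one_mul] at h2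
      exact h2.symm.le
    exact IsUnit.of_mul_eq_one ⟨_, hi⟩ (Subtype.ext (mul_inv_cancel₀ hx0))
  · rintro h ⟨u, rfl⟩
    have h2 := spectralNorm_mul_of_isAlgebraic p F (u : ringOfIntegers p F)
      (↑u⁻¹ : ringOfIntegers p F)
    rw [← MulMemClass.coe_mul, Units.mul_inv, OneMemClass.coe_one, spectralNorm_one] at h2
    have h3 : spectralNorm ℚ_[p] F (↑u⁻¹ : ringOfIntegers p F) ≤ 1 :=
      (↑u⁻¹ : ringOfIntegers p F).2
    nlinarith [spectralNorm_nonneg (K := ℚ_[p]) ((u : ringOfIntegers p F) : F),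
      spectralNorm_nonneg (K := ℚ_[p]) ((↑u⁻¹ : ringOfIntegers p F) : F)]

theorem natCast_residueCard : (residueCard p F : ResidueField (ringOfIntegers p F)) = 0 := by
  have := Fintype.ofFinite (ResidueField (ringOfIntegers p F))
  rw [residueCard, Nat.card_eq_fintype_card]
  exact FiniteField.cast_card_eq_zero _

/-- Factor `y ^ q - 1 = (1 + y + ⋯ + y ^ (q - 1)) (y - 1)`. As `y` reduces to `1`, the first factor
reduces to `q = 0`, which gains one power of the maximal ideal. -/
theorem pow_residueCard_sub_one_mem {j : ℕ} (hj : j ≠ 0) {y : ringOfIntegers p F}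
    (hy : y - 1 ∈ maximalIdeal (ringOfIntegers p F) ^ j) :
    y ^ residueCard p F - 1 ∈ maximalIdeal (ringOfIntegers p F) ^ (j + 1) := by
  rw [← mul_geom_sum, pow_succ]
  refine Ideal.mul_mem_mul hy ?_
  have hy1 : residue _ y = 1 := by
    rw [← sub_eq_zero, ← map_one (residue _), ← map_sub, residue_eq_zero_iff]
    exact Ideal.pow_le_self hj hy
  rw [← residue_eq_zero_iff, map_sum]
  simp [hy1, natCast_residueCard]

theorem pow_pow_residueCard_sub_one_mem {y : ringOfIntegers p F}
    (hy : y - 1 ∈ maximalIdeal (ringOfIntegers p F)) (j : ℕ) :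
    y ^ residueCard p F ^ j - 1 ∈ maximalIdeal (ringOfIntegers p F) ^ (j + 1) := by
  induction j with
  | zero => simpa using hy
  | succ j ih =>
    rw [pow_succ (residueCard p F), pow_mul]
    exact pow_residueCard_sub_one_mem p F j.succ_ne_zero ih

/-- Turns congruences modulo powers of the maximal ideal into norm estimates; `r` is the norm of a
uniformizer. -/
theorem exists_spectralNorm_le_of_mem_pow : ∃ r : ℝ, 0 ≤ r ∧ r < 1 ∧ ∀ (j : ℕ)
    (x : ringOfIntegers p F), x ∈ maximalIdeal (ringOfIntegers p F) ^ j →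
      spectralNorm ℚ_[p] F x ≤ r ^ j := by
  obtain ⟨π, hπ⟩ := IsDiscreteValuationRing.exists_irreducible (ringOfIntegers p F)
  refine ⟨spectralNorm ℚ_[p] F π, spectralNorm_nonneg _, ?_, fun j x hx => ?_⟩
  · rw [← mem_maximalIdeal_integers_iff, hπ.maximalIdeal_eq]
    exact Ideal.mem_span_singleton_self π
  · rw [hπ.maximalIdeal_eq, Ideal.span_singleton_pow, Ideal.mem_span_singleton] at hx
    obtain ⟨c, rfl⟩ := hx
    rw [MulMemClass.coe_mul, SubmonoidClass.coe_pow, spectralNorm_mul_of_isAlgebraic,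
      spectralNorm_pow_of_isAlgebraic]
    exact mul_le_of_le_one_right (pow_nonneg (spectralNorm_nonneg _) _) c.2

/-- The lift `t` is a limit point of the sequence `x ^ q ^ j`. Compactness of the unit ball supplies
a convergent subsequence, which is enough. -/
theorem exists_pow_residueCard_sub_one_eq_one (x : ringOfIntegers p F)
    (hx : x ∉ maximalIdeal (ringOfIntegers p F)) :
    ∃ t : ringOfIntegers p F, t ^ (residueCard p F - 1) = 1 ∧ residue _ t = residue _ x := by
  have := Fintype.ofFinite (ResidueField (ringOfIntegers p F))
  set q := residueCard p F with hq
  have hqc : q = Fintype.card (ResidueField (ringOfIntegers p F)) := Nat.card_eq_fintype_card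
  have hx1 : x ^ (q - 1) - 1 ∈ maximalIdeal (ringOfIntegers p F) := by
    rw [← residue_eq_zero_iff, map_sub, map_pow, map_one, hqc, FiniteField.pow_card_sub_one_eq_one,
      sub_self]
    rwa [Ne, residue_eq_zero_iff]
  obtain ⟨r, hr0, hr1, hr⟩ := exists_spectralNorm_le_of_mem_pow p F
  let : NontriviallyNormedField F := spectralNorm.nontriviallyNormedField ℚ_[p] F
  let : NormedSpace ℚ_[p] F := spectralNorm.normedSpace ℚ_[p] F
  have : ProperSpace F := FiniteDimensional.proper ℚ_[p] F
  have hmem : ∀ j : ℕ, (x : F) ^ q ^ j ∈ Metric.closedBall (0 : F) 1 := fun j => by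
    rw [mem_closedBall_zero_iff]
    exact (x ^ q ^ j).2
  obtain ⟨t, ht, φ, hφ, hlim⟩ := (isCompact_closedBall (0 : F) 1).tendsto_subseq hmem
  rw [mem_closedBall_zero_iff] at ht
  refine ⟨⟨t, ht⟩, Subtype.ext ?_, ?_⟩
  · show t ^ (q - 1) = 1
    -- The term is also `(x ^ (q - 1)) ^ q ^ φ j - 1`, and `x ^ (q - 1)` reduces to `1`, so it tends
    -- to `0`.
    have h1 : Filter.Tendsto (fun j => ((x : F) ^ q ^ φ j) ^ (q - 1) - 1) Filter.atTop
        (nhds (t ^ (q - 1) - 1)) := (hlim.pow (q - 1)).sub_const 1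
    have h2 : Filter.Tendsto (fun j => ((x : F) ^ q ^ φ j) ^ (q - 1) - 1) Filter.atTop
        (nhds 0) := by
      refine squeeze_zero_norm (a := fun j => r ^ (φ j + 1)) (fun j => ?_) ?_
      · have h := hr _ _ (pow_pow_residueCard_sub_one_mem p F hx1 (φ j))
        rw [← pow_mul, mul_comm, pow_mul] at h
        exact h
      · exact (tendsto_pow_atTop_nhds_zero_of_lt_one hr0 hr1).comp
          ((Filter.tendsto_add_atTop_nat 1).comp hφ.tendsto_atTop)
    exact sub_eq_zero.1 (tendsto_nhds_unique h1 h2)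
  -- A term at distance less than `1` from `t` has the same residue as `t`; it also has the residue
  -- of `x`, because raising to a power `q ^ i` is the identity on the residue field.
  · obtain ⟨j, hj⟩ := (hlim.eventually (Metric.ball_mem_nhds t one_pos)).exists
    have h1 : x ^ q ^ φ j - ⟨t, ht⟩ ∈ maximalIdeal (ringOfIntegers p F) := by
      rw [mem_maximalIdeal_integers_iff]
      rw [dist_eq_norm] at hj
      exact hj
    rw [← residue_eq_zero_iff, map_sub, sub_eq_zero, map_pow, hqc,
      FiniteField.pow_card_pow] at h1
    exact h1.symm

/-- Lift a generator of the cyclic group of units of the residue field. The lift is killed by `q -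
1`, and its order is at least that of its residue. -/
theorem exists_isPrimitiveRoot_residueCard :
    ∃ ζ : F, IsPrimitiveRoot ζ (residueCard p F - 1) := by
  have := Fintype.ofFinite (ResidueField (ringOfIntegers p F))
  obtain ⟨g, hg⟩ := IsCyclic.exists_generator (α := (ResidueField (ringOfIntegers p F))ˣ)
  obtain ⟨x, hx⟩ := residue_surjective (g : ResidueField (ringOfIntegers p F))
  have hxm : x ∉ maximalIdeal (ringOfIntegers p F) := by
    rw [← residue_eq_zero_iff, hx]
    exact g.ne_zero
  obtain ⟨t, ht, htx⟩ := exists_pow_residueCard_sub_one_eq_one p F x hxm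
  have hord : orderOf g = residueCard p F - 1 := by
    rw [orderOf_eq_card_of_forall_mem_zpowers hg, Nat.card_units, residueCard]
  refine ⟨t, ?_⟩
  refine IsPrimitiveRoot.map_of_injective (f := (ringOfIntegers p F).subtype) ?_
    Subtype.val_injective
  refine ⟨ht, fun n hn => ?_⟩
  rw [← hord, orderOf_dvd_iff_pow_eq_one]
  apply Units.ext
  rw [Units.val_pow_eq_pow_val, ← hx, ← htx, ← map_pow, hn, map_one, Units.val_one]

variable {F}

theorem mem_ringOfIntegers_of_pow_eq_one {x : F} {n : ℕ} (hn : n ≠ 0) (hx : x ^ n = 1) :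
    x ∈ ringOfIntegers p F := by
  rw [mem_ringOfIntegers]
  have h := spectralNorm_pow_of_isAlgebraic p F x n
  rw [hx, spectralNorm_one] at h
  exact ((pow_eq_one_iff_of_nonneg (spectralNorm_nonneg x) hn).1 h.symm).le

/-- Reduction is injective on roots of unity of order prime to the residue characteristic: in `(1 +
y + ⋯ + y ^ (n - 1)) (y - 1) = 0` the first factor has residue `n`, which is nonzero. -/
theorem eq_one_of_residue_eq_one {n : ℕ} (hn : (n : ResidueField (ringOfIntegers p F)) ≠ 0)
    {y : ringOfIntegers p F} (hy : y ^ n = 1) (h : residue _ y = 1) : y = 1 := by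
  have h0 : (∑ i ∈ Finset.range n, y ^ i) * (y - 1) = 0 := by
    rw [geom_sum_mul, hy, sub_self]
  rcases mul_eq_zero.1 h0 with h0 | h0
  · refine absurd ?_ hn
    have := congrArg (residue _) h0
    rw [map_sum, map_zero] at this
    simpa [h] using this
  · exact sub_eq_zero.1 h0

variable (F) (E : Type*) [Field E] [Algebra ℚ_[p] E] [Algebra F E] [IsScalarTower ℚ_[p] F E]
  [FiniteDimensional ℚ_[p] E]

attribute [local instance] integersAlgebra

theorem natCast_residueCard_pow_sub_one_ne_zero {m : ℕ} (hm : m ≠ 0) :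
    ((residueCard p F ^ m - 1 : ℕ) : ResidueField (ringOfIntegers p E)) ≠ 0 := by
  have h : (residueCard p F : ResidueField (ringOfIntegers p E)) = 0 := by
    rw [← map_natCast (algebraMap (ResidueField (ringOfIntegers p F))
      (ResidueField (ringOfIntegers p E))), natCast_residueCard, map_zero]
  rw [Nat.cast_sub (Nat.one_le_pow _ _ (zero_lt_one.trans (one_lt_residueCard p F))), Nat.cast_pow,
    h, zero_pow hm]
  simp

theorem residueCard_pow_sub_one_ne_zero {m : ℕ} (hm : m ≠ 0) : residueCard p F ^ m - 1 ≠ 0 :=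
  (Nat.sub_pos_of_lt (Nat.one_lt_pow hm (one_lt_residueCard p F))).ne'

-- The residue of `ζ` still has order `q ^ m - 1`, which therefore divides `q ^ f - 1`, where `f` is
-- the residue degree. Then `gcd (q ^ m - 1, q ^ f - 1) = q ^ gcd (m, f) - 1` gives `m ∣ f`.
variable {E} in
theorem dvd_residueDegree_of_isPrimitiveRoot {m : ℕ} (hm : m ≠ 0) {ζ : E}
    (hζ : IsPrimitiveRoot ζ (residueCard p F ^ m - 1)) : m ∣ residueDegree p F E := by
  have := Fintype.ofFinite (ResidueField (ringOfIntegers p E))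
  have hn0 := residueCard_pow_sub_one_ne_zero p F hm
  set n := residueCard p F ^ m - 1 with hn
  let z : ringOfIntegers p E := ⟨ζ, mem_ringOfIntegers_of_pow_eq_one p hn0 hζ.pow_eq_one⟩
  have hz : IsPrimitiveRoot z n :=
    IsPrimitiveRoot.of_map_of_injective (f := (ringOfIntegers p E).subtype) hζ
      Subtype.val_injective
  have hr : IsPrimitiveRoot (residue _ z) n := by
    refine ⟨by rw [← map_pow, hz.pow_eq_one, map_one], fun i hi => hz.dvd_of_pow_eq_one i ?_⟩
    refine eq_one_of_residue_eq_one p (natCast_residueCard_pow_sub_one_ne_zero p F E hm) ?_ ?_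
    · rw [← pow_mul, mul_comm, pow_mul, hz.pow_eq_one, one_pow]
    · rw [map_pow, hi]
  have hd : n ∣ residueCard p F ^ residueDegree p F E - 1 := by
    refine hr.dvd_of_pow_eq_one _ ?_
    rw [← residueCard_eq_pow, residueCard, Nat.card_eq_fintype_card]
    exact FiniteField.pow_card_sub_one_eq_one _ (hr.ne_zero hn0)
  have hg := Nat.pow_sub_one_gcd_pow_sub_one (residueCard p F) m (residueDegree p F E)
  rw [Nat.gcd_eq_left hd] at hg
  have h1 : ∀ j, 1 ≤ residueCard p F ^ j :=
    fun j => Nat.one_le_pow _ _ (zero_lt_one.trans (one_lt_residueCard p F))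
  have h2 : residueCard p F ^ m = residueCard p F ^ m.gcd (residueDegree p F E) := by
    have := h1 m; have := h1 (m.gcd (residueDegree p F E)); omega
  exact Nat.gcd_eq_left_iff_dvd.1 (Nat.pow_right_injective (one_lt_residueCard p F) h2).symm

/-- An automorphism of an extension restricts to the ring of integers. -/
def integersEquiv (σ : E ≃ₐ[F] E) : ringOfIntegers p E ≃+* ringOfIntegers p E :=
  have h : ∀ τ : E ≃ₐ[F] E, ∀ x ∈ ringOfIntegers p E, τ x ∈ ringOfIntegers p E := by
    intro τ x hx
    rw [mem_ringOfIntegers] at hx ⊢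
    exact (spectralNorm_eq_of_equiv (τ.restrictScalars ℚ_[p]) x).symm.trans_le hx
  { toFun := fun x => ⟨σ x.1, h σ _ x.2⟩
    invFun := fun x => ⟨σ.symm x.1, h σ.symm _ x.2⟩
    left_inv := fun x => Subtype.ext (by simp)
    right_inv := fun x => Subtype.ext (by simp)
    map_mul' := fun x y => Subtype.ext (map_mul σ x.1 y.1)
    map_add' := fun x y => Subtype.ext (map_add σ x.1 y.1) }

/-- The automorphism of the residue field extension induced by an automorphism. -/
def residueFieldEquiv (σ : E ≃ₐ[F] E) :
    ResidueField (ringOfIntegers p E) ≃ₐ[ResidueField (ringOfIntegers p F)]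
      ResidueField (ringOfIntegers p E) :=
  AlgEquiv.ofRingEquiv (f := ResidueField.mapEquiv (integersEquiv p F E σ)) fun x => by
    obtain ⟨x, rfl⟩ := residue_surjective x
    show residue _ (integersEquiv p F E σ (algebraMap _ _ x)) = residue _ (algebraMap _ _ x)
    congr 1
    exact Subtype.ext (σ.commutes x)

/-- On the residue field `σ` induces a power of Frobenius, and a root of unity of order dividing `q
^ m - 1` is determined by its residue. The exponent comes from the residue field alone, so one `a`
serves every `m`. -/
theorem exists_pow_eq_of_pow_eq_one (σ : E ≃ₐ[F] E) :
    ∃ a : ℕ, ∀ m : ℕ, m ≠ 0 → ∀ ζ : E, ζ ^ (residueCard p F ^ m - 1) = 1 →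
      σ ζ = ζ ^ residueCard p F ^ a := by
  have := Fintype.ofFinite (ResidueField (ringOfIntegers p F))
  obtain ⟨a, ha⟩ := (FiniteField.bijective_frobeniusAlgEquivOfAlgebraic_pow
    (ResidueField (ringOfIntegers p F)) (ResidueField (ringOfIntegers p E))).2
      (residueFieldEquiv p F E σ)
  refine ⟨a, fun m hm ζ hζ => ?_⟩
  have hn0 := residueCard_pow_sub_one_ne_zero p F hm
  let z : ringOfIntegers p E := ⟨ζ, mem_ringOfIntegers_of_pow_eq_one p hn0 hζ⟩
  have hz : z ^ (residueCard p F ^ m - 1) = 1 := Subtype.ext hζ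
  obtain ⟨u, hu⟩ := IsUnit.of_pow_eq_one hz hn0
  have hu1 : u ^ (residueCard p F ^ m - 1) = 1 := Units.ext (by
    rw [Units.val_pow_eq_pow_val, hu, hz, Units.val_one])
  let s := Units.map (integersEquiv p F E σ : ringOfIntegers p E →* ringOfIntegers p E)
  have hres : residue _ (s u : ringOfIntegers p E) =
      residue _ ((u ^ residueCard p F ^ (a : ℕ) : (ringOfIntegers p E)ˣ) : ringOfIntegers p E) := by
    rw [Units.val_pow_eq_pow_val, map_pow]
    have h := DFunLike.congr_fun ha (residue _ (u : ringOfIntegers p E))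
    have h' : residue _ (s u : ringOfIntegers p E) =
      residueFieldEquiv p F E σ (residue _ (u : ringOfIntegers p E)) := rfl
    rw [h', ← h, AlgEquiv.coe_pow, FiniteField.coe_frobeniusAlgEquivOfAlgebraic, pow_iterate,
      residueCard, Nat.card_eq_fintype_card]
  have hone : s u * (u ^ residueCard p F ^ (a : ℕ))⁻¹ = 1 := by
    apply Units.ext
    refine eq_one_of_residue_eq_one p (natCast_residueCard_pow_sub_one_ne_zero p F E hm) ?_ ?_
    · rw [← Units.val_pow_eq_pow_val, mul_pow, ← map_pow, hu1, inv_pow, ← pow_mul,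
        mul_comm (residueCard p F ^ (a : ℕ)), pow_mul, hu1]
      simp
    · rw [Units.val_mul, map_mul, hres, ← map_mul, Units.mul_inv, map_one]
  have h := congrArg (fun v : (ringOfIntegers p E)ˣ => ((v : ringOfIntegers p E) : E))
    (mul_inv_eq_one.1 hone)
  simp only [Units.val_pow_eq_pow_val, hu] at h
  have h3 : ((s u : ringOfIntegers p E) : E) = σ ((u : ringOfIntegers p E) : E) := rfl
  rw [h3, hu] at h
  exact h

end RootsOfUnity

/-! ### Unramified extensions as extensions by roots of unity -/

section UnramifiedExtension

open Polynomial IntermediateField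

variable (p : ℕ) [Fact p.Prime] (k : Type*) [Field k] [Algebra ℚ_[p] k] [FiniteDimensional ℚ_[p] k]

/-- The extension of `k` generated by the roots of unity of order dividing `q ^ m - 1`, where `q` is
the cardinality of the residue field of `k`. -/
def unramifiedExtension (m : ℕ) : IntermediateField k (AlgebraicClosure k) :=
  adjoin k ((X ^ (residueCard p k ^ m - 1) - 1 : k[X]).rootSet (AlgebraicClosure k))

instance unramifiedExtension_isSplittingField (m : ℕ) :
    (X ^ (residueCard p k ^ m - 1) - 1 : k[X]).IsSplittingField k (unramifiedExtension p k m) :=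
  adjoin_rootSet_isSplittingField (IsAlgClosed.splits _)

instance unramifiedExtension_finiteDimensional (m : ℕ) :
    FiniteDimensional k (unramifiedExtension p k m) :=
  IsSplittingField.finiteDimensional _ (X ^ (residueCard p k ^ m - 1) - 1 : k[X])

instance unramifiedExtension_isGalois (m : ℕ) : IsGalois k (unramifiedExtension p k m) := by
  have := charZero_padic_algebra p k
  have : Normal k (unramifiedExtension p k m) :=
    Normal.of_isSplittingField (X ^ (residueCard p k ^ m - 1) - 1 : k[X])
  exact ⟨⟩

variable {k} in
theorem mem_rootSet_residueCard_iff {m : ℕ} (hm : m ≠ 0) {x : AlgebraicClosure k} :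
    x ∈ (X ^ (residueCard p k ^ m - 1) - 1 : k[X]).rootSet (AlgebraicClosure k) ↔
      x ^ (residueCard p k ^ m - 1) = 1 := by
  have h : (X ^ (residueCard p k ^ m - 1) - 1 : k[X]) ≠ 0 :=
    (monic_X_pow_sub_C (1 : k) (residueCard_pow_sub_one_ne_zero p k hm)).ne_zero
  rw [mem_rootSet_of_ne h]
  simp [sub_eq_zero]

variable {k} in
theorem mem_unramifiedExtension {m : ℕ} (hm : m ≠ 0) {x : AlgebraicClosure k}
    (hx : x ^ (residueCard p k ^ m - 1) = 1) : x ∈ unramifiedExtension p k m :=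
  subset_adjoin _ _ ((mem_rootSet_residueCard_iff p hm).2 hx)

theorem unramifiedExtension_le {m : ℕ} (hm : m ≠ 0)
    {L : IntermediateField k (AlgebraicClosure k)}
    (h : ∀ x : AlgebraicClosure k, x ^ (residueCard p k ^ m - 1) = 1 → x ∈ L) :
    unramifiedExtension p k m ≤ L :=
  adjoin_le_iff.2 fun x hx => h x ((mem_rootSet_residueCard_iff p hm).1 hx)

theorem exists_isPrimitiveRoot_algebraicClosure {m : ℕ} (hm : m ≠ 0) :
    ∃ ζ : AlgebraicClosure k, IsPrimitiveRoot ζ (residueCard p k ^ m - 1) := by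
  have := charZero_padic_algebra p k
  have : NeZero (residueCard p k ^ m - 1) := ⟨residueCard_pow_sub_one_ne_zero p k hm⟩
  have : CharZero (AlgebraicClosure k) := charZero_of_injective_algebraMap
    (algebraMap k (AlgebraicClosure k)).injective
  have := HasEnoughRootsOfUnity.exists_primitiveRoot (AlgebraicClosure k)
    (residueCard p k ^ m - 1)
  exact this

variable {k}

/-- The multiplicative order of `q` modulo `q ^ m - 1` is `m`. -/
theorem pow_eq_pow_iff_modEq {m : ℕ} (hm : m ≠ 0) {ζ : AlgebraicClosure k}
    (hζ : IsPrimitiveRoot ζ (residueCard p k ^ m - 1)) {a b : ℕ} :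
    ζ ^ residueCard p k ^ a = ζ ^ residueCard p k ^ b ↔ a ≡ b [MOD m] := by
  have hq := one_lt_residueCard p k
  set q := residueCard p k
  have h1 : 1 ≤ q ^ m := Nat.one_le_pow _ _ (by omega)
  have hqm : q ^ m ≡ 1 [MOD q ^ m - 1] :=
    ((Nat.modEq_iff_dvd' h1).2 (dvd_refl _)).symm
  have hred : ∀ a, q ^ a ≡ q ^ (a % m) [MOD q ^ m - 1] := fun a => by
    conv_lhs => rw [← Nat.mod_add_div a m, pow_add, pow_mul]
    simpa using (hqm.pow (a / m)).mul_left (q ^ (a % m))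
  have hlt : ∀ a, q ^ (a % m) < q ^ m := fun a =>
    Nat.pow_lt_pow_right hq (Nat.mod_lt _ (Nat.pos_of_ne_zero hm))
  have hmod : ζ ^ q ^ a = ζ ^ q ^ b ↔ q ^ a ≡ q ^ b [MOD q ^ m - 1] := by
    obtain ⟨u, hu⟩ := hζ.isUnit (residueCard_pow_sub_one_ne_zero p k hm)
    rw [hζ.eq_orderOf, ← hu, orderOf_units, ← _root_.pow_eq_pow_iff_modEq, Units.ext_iff,
      Units.val_pow_eq_pow_val, Units.val_pow_eq_pow_val]
  rw [hmod]
  constructor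
  · intro h
    have h' : q ^ (a % m) ≡ q ^ (b % m) [MOD q ^ m - 1] := (hred a).symm.trans (h.trans (hred b))
    clear hmod
    wlog hab : a % m ≤ b % m generalizing a b
    · exact (this h.symm h'.symm (by omega)).symm
    -- With reduced exponents both powers lie between `1` and `q ^ m - 1`, so their difference is
    -- too small to be a nonzero multiple of `q ^ m - 1`.
    have hd := (Nat.modEq_iff_dvd' (Nat.pow_le_pow_right (by omega) hab)).1 h'
    have hpos : 0 < q ^ (a % m) := Nat.pow_pos (by omega)
    rcases Nat.eq_zero_or_pos (q ^ (b % m) - q ^ (a % m)) with h0 | h0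
    · refine Nat.pow_right_injective hq (le_antisymm ?_ ?_)
      · exact Nat.pow_le_pow_right (by omega) hab
      · exact Nat.sub_eq_zero_iff_le.1 h0
    · exfalso
      have h2 := Nat.le_of_dvd h0 hd
      have h3 := hlt b
      have ha : q ^ (a % m) = 1 := by omega
      have hb : q ^ (b % m) = q ^ m := by omega
      omega
  · intro h
    refine (hred a).trans ?_
    rw [show a % m = b % m from h]
    exact (hred b).symm

variable (k)

theorem exists_algEquiv_pow (τ : AlgebraicClosure k ≃ₐ[k] AlgebraicClosure k) {m : ℕ}
    (hm : m ≠ 0) : ∃ a : ℕ, ∀ x : AlgebraicClosure k, x ^ (residueCard p k ^ m - 1) = 1 →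
      τ x = x ^ residueCard p k ^ a := by
  have := finiteDimensional_padic p k (unramifiedExtension p k m)
  obtain ⟨a, ha⟩ := exists_pow_eq_of_pow_eq_one p k (unramifiedExtension p k m)
    (τ.restrictNormal (unramifiedExtension p k m))
  refine ⟨a, fun x hx => ?_⟩
  have h := ha m hm ⟨x, mem_unramifiedExtension p hm hx⟩ (Subtype.ext hx)
  have h2 := τ.restrictNormal_commutes (unramifiedExtension p k m)
    ⟨x, mem_unramifiedExtension p hm hx⟩
  rw [h] at h2
  exact h2.symm

/-- An automorphism is determined by its action on the generating roots of unity, hence by its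
Frobenius exponent modulo `m`. This bounds the degree of the extension by `m`. -/
theorem exists_injective_gal_fin {m : ℕ} (hm : m ≠ 0) :
    ∃ φ : Gal(unramifiedExtension p k m/k) → Fin m, Function.Injective φ ∧
      ∀ σ, ∀ x : unramifiedExtension p k m, x ^ (residueCard p k ^ m - 1) = 1 →
        σ x = x ^ residueCard p k ^ (φ σ : ℕ) := by
  have := finiteDimensional_padic p k (unramifiedExtension p k m)
  have : NeZero m := ⟨hm⟩
  choose a ha using exists_pow_eq_of_pow_eq_one p k (unramifiedExtension p k m)
  obtain ⟨ζ, hζ⟩ := exists_isPrimitiveRoot_algebraicClosure p k hm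
  have key : ∀ σ, ∀ x : unramifiedExtension p k m, x ^ (residueCard p k ^ m - 1) = 1 →
      σ x = x ^ residueCard p k ^ (a σ % m) := by
    intro σ x hx
    rw [ha σ m hm x hx]
    have hx' : (x : AlgebraicClosure k) ^ (residueCard p k ^ m - 1) = 1 := congrArg Subtype.val hx
    have : NeZero (residueCard p k ^ m - 1) := ⟨residueCard_pow_sub_one_ne_zero p k hm⟩
    obtain ⟨i, -, hi⟩ := hζ.eq_pow_of_pow_eq_one hx'
    apply Subtype.ext
    show (x : AlgebraicClosure k) ^ _ = (x : AlgebraicClosure k) ^ _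
    rw [← hi, ← pow_mul, mul_comm, pow_mul,
      (pow_eq_pow_iff_modEq p hm hζ).2 (Nat.mod_modEq (a σ) m).symm, ← pow_mul, mul_comm, pow_mul]
  refine ⟨fun σ => Fin.ofNat m (a σ), fun σ τ hστ => ?_, key⟩
  have hστ' : a σ % m = a τ % m := congrArg Fin.val hστ
  have h : (σ : unramifiedExtension p k m →ₐ[k] unramifiedExtension p k m) = τ := by
    refine adjoin_algHom_ext k fun x hx => ?_
    have hx' : (⟨x, subset_adjoin _ _ hx⟩ : unramifiedExtension p k m) ^
        (residueCard p k ^ m - 1) = 1 := Subtype.ext ((mem_rootSet_residueCard_iff p hm).1 hx)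
    exact ((key σ _ hx').trans (by rw [hστ'])).trans (key τ _ hx').symm
  exact AlgEquiv.coe_toAlgHom_injective h

/-- Squeeze: `m` divides the residue degree because of the primitive root of unity, the residue
degree divides the degree, and the degree is at most `m`. -/
theorem residueDegree_unramifiedExtension_and_finrank {m : ℕ} (hm : m ≠ 0) :
    haveI := finiteDimensional_padic p k (unramifiedExtension p k m)
    residueDegree p k (unramifiedExtension p k m) = m ∧
      Module.finrank k (unramifiedExtension p k m) = m := by
  have := finiteDimensional_padic p k (unramifiedExtension p k m)
  obtain ⟨φ, hφ, -⟩ := exists_injective_gal_fin p k hm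
  have h1 := Nat.card_le_card_of_injective φ hφ
  rw [IsGalois.card_aut_eq_finrank, Nat.card_fin] at h1
  obtain ⟨ζ, hζ⟩ := exists_isPrimitiveRoot_algebraicClosure p k hm
  have h2 : m ∣ residueDegree p k (unramifiedExtension p k m) :=
    dvd_residueDegree_of_isPrimitiveRoot p k hm
      (ζ := ⟨ζ, mem_unramifiedExtension p hm hζ.pow_eq_one⟩)
      (IsPrimitiveRoot.of_map_of_injective (f := (unramifiedExtension p k m).val) hζ
        Subtype.val_injective)
  have h3 := residueDegree_dvd_finrank p k (unramifiedExtension p k m)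
  have h4 := Nat.le_of_dvd Module.finrank_pos h3
  have h5 := Nat.le_of_dvd (residueDegree_pos p k (unramifiedExtension p k m)) h2
  omega

theorem finrank_unramifiedExtension {m : ℕ} (hm : m ≠ 0) :
    Module.finrank k (unramifiedExtension p k m) = m :=
  (residueDegree_unramifiedExtension_and_finrank p k hm).2

/-- The degree is exactly `m`, so the injection of the Galois group into `Fin m` is bijective and
every exponent occurs; the automorphism is then lifted to the algebraic closure. -/
theorem exists_algEquiv_eq_pow {m : ℕ} (hm : m ≠ 0) (a : ℕ) :
    ∃ τ : AlgebraicClosure k ≃ₐ[k] AlgebraicClosure k, ∀ x : AlgebraicClosure k,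
      x ^ (residueCard p k ^ m - 1) = 1 → τ x = x ^ residueCard p k ^ a := by
  obtain ⟨φ, hφ, h⟩ := exists_injective_gal_fin p k hm
  have : NeZero m := ⟨hm⟩
  obtain ⟨ζ, hζ⟩ := exists_isPrimitiveRoot_algebraicClosure p k hm
  have hb : Function.Bijective φ := hφ.bijective_of_nat_card_le (by
    rw [IsGalois.card_aut_eq_finrank, finrank_unramifiedExtension p k hm, Nat.card_fin])
  obtain ⟨σ, hσ⟩ := hb.2 (Fin.ofNat m a)
  refine ⟨σ.liftNormal _, fun x hx => ?_⟩
  have h1 := h σ ⟨x, mem_unramifiedExtension p hm hx⟩ (Subtype.ext hx)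
  have h2 := σ.liftNormal_commutes (AlgebraicClosure k) ⟨x, mem_unramifiedExtension p hm hx⟩
  rw [h1, hσ] at h2
  refine h2.trans ?_
  show x ^ residueCard p k ^ (a % m) = _
  have : NeZero (residueCard p k ^ m - 1) := ⟨residueCard_pow_sub_one_ne_zero p k hm⟩
  obtain ⟨i, -, rfl⟩ := hζ.eq_pow_of_pow_eq_one hx
  rw [← pow_mul, mul_comm, pow_mul, (pow_eq_pow_iff_modEq p hm hζ).2 (Nat.mod_modEq a m),
    ← pow_mul, mul_comm, pow_mul]

/-- `L` contains a primitive root of unity of order `q_L - 1 = q ^ f - 1`, where `f` is its residue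
degree, and `q ^ m - 1` divides this when `m ∣ f`. -/
theorem unramifiedExtension_le_of_dvd {m : ℕ} (hm : m ≠ 0)
    (L : IntermediateField k (AlgebraicClosure k)) [FiniteDimensional k L]
    (h : haveI := finiteDimensional_padic p k L; m ∣ residueDegree p k L) :
    unramifiedExtension p k m ≤ L := by
  have := finiteDimensional_padic p k L
  obtain ⟨ζ, hζ⟩ := exists_isPrimitiveRoot_residueCard p L
  have hζ' := hζ.map_of_injective (f := L.val) Subtype.val_injective
  have : NeZero (residueCard p L - 1) := ⟨(Nat.sub_pos_of_lt (one_lt_residueCard p L)).ne'⟩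
  refine unramifiedExtension_le p k hm fun x hx => ?_
  have hd : residueCard p k ^ m - 1 ∣ residueCard p L - 1 := by
    rw [residueCard_eq_pow p k L]
    exact Nat.pow_sub_one_dvd_pow_sub_one _ h
  obtain ⟨i, -, rfl⟩ := hζ'.eq_pow_of_pow_eq_one (orderOf_dvd_iff_pow_eq_one.1
    ((orderOf_dvd_of_pow_eq_one hx).trans hd))
  exact pow_mem ζ.2 i

theorem unramifiedExtension_mono {m n : ℕ} (hn : n ≠ 0) (h : m ∣ n) :
    unramifiedExtension p k m ≤ unramifiedExtension p k n := by
  refine unramifiedExtension_le_of_dvd p k (ne_zero_of_dvd_ne_zero hn h) _ ?_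
  rw [(residueDegree_unramifiedExtension_and_finrank p k hn).1]
  exact h

theorem isUnramified_iff (E : IntermediateField k (AlgebraicClosure k)) [FiniteDimensional k E] :
    haveI := finiteDimensional_padic p k E
    IsUnramified p k E ↔ residueDegree p k E = Module.finrank k E :=
  haveI := finiteDimensional_padic p k E
  forall_normalizedVal_eq_iff p k E

theorem eq_unramifiedExtension (E : IntermediateField k (AlgebraicClosure k))
    [FiniteDimensional k E] (h : IsUnramified p k E) :
    E = unramifiedExtension p k (Module.finrank k E) := by
  have hn : Module.finrank k E ≠ 0 := Module.finrank_pos.ne'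
  refine (eq_of_le_of_finrank_eq (unramifiedExtension_le_of_dvd p k hn E ?_) ?_).symm
  · rw [(isUnramified_iff p k E).1 h]
  · rw [finrank_unramifiedExtension p k hn]

end UnramifiedExtension

/-! ### The `ℓ`-adic valuation: surjectivity and behaviour under the norm -/

section LAdicValuation

variable (p : ℕ) [Fact p.Prime] (ℓ : ℕ) [Fact ℓ.Prime]
  (F E : Type*) [Field F] [Field E] [Algebra ℚ_[p] F]
  [Algebra ℚ_[p] E] [Algebra F E] [IsScalarTower ℚ_[p] F E]
  [FiniteDimensional ℚ_[p] F] [FiniteDimensional ℚ_[p] E]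

theorem toZModPow_lAdicVal (a : lAdification ℓ Fˣ) (n : ℕ) (x : Fˣ)
    (hx : QuotientGroup.mk x = a.1 n) :
    (Multiplicative.toAdd (lAdicVal p F ℓ a)).toZModPow n =
      (Multiplicative.toAdd (normalizedVal p F x) : ℤ) := by
  refine toZModPow_padicIntOf ℓ _ n _ ?_
  show _ = levelMap ℓ (normalizedVal p F) n (a.1 n)
  rw [← hx]
  rfl

theorem lAdicVal_surjective : Function.Surjective (lAdicVal p F ℓ) := by
  obtain ⟨u, hu⟩ := normalizedVal_surjective p F (Multiplicative.ofAdd 1)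
  intro z
  let y : ℤ_[ℓ] := Multiplicative.toAdd z
  -- The preimage of `y` is "`u ^ y`" for a uniformizer `u`: at level `n` the exponent is a natural
  -- number congruent to `y` modulo `ℓ ^ n`.
  refine ⟨⟨fun n => QuotientGroup.mk (u ^ y.appr n), fun n => ?_⟩, ?_⟩
  · show QuotientGroup.mk (u ^ y.appr (n + 1)) = QuotientGroup.mk (u ^ y.appr n)
    obtain ⟨c, hc⟩ := y.dvd_appr_sub_appr n (n + 1) n.le_succ
    have hle := y.appr_mono n.le_succ
    rw [eq_comm, QuotientGroup.eq]
    refine ⟨u ^ c, ?_⟩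
    rw [powMonoidHom_apply, ← pow_mul, mul_comm c, ← hc, eq_inv_mul_iff_mul_eq, ← pow_add]
    congr 1
    exact Nat.add_sub_cancel' hle
  · refine Multiplicative.toAdd.injective (PadicInt.ext_of_toZModPow.1 fun n => ?_)
    rw [toZModPow_lAdicVal p ℓ F _ n (u ^ y.appr n) rfl, map_pow, hu, toAdd_pow, toAdd_ofAdd]
    have h := y.appr_spec n
    rw [← PadicInt.ker_toZModPow, RingHom.mem_ker, map_sub, map_natCast, sub_eq_zero] at h
    simpa using h.symm

theorem lAdicVal_range : (lAdicVal p F ℓ).range = ⊤ :=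
  MonoidHom.range_eq_top.2 (lAdicVal_surjective p ℓ F)

theorem lAdicVal_lAdicNorm (a : lAdification ℓ Eˣ) :
    lAdicVal p F ℓ (lAdicNorm ℓ F E a) = lAdicVal p E ℓ a ^ residueDegree p F E := by
  refine Multiplicative.toAdd.injective (PadicInt.ext_of_toZModPow.1 fun n => ?_)
  obtain ⟨x, hx⟩ := QuotientGroup.mk_surjective (a.1 n)
  rw [toZModPow_lAdicVal p ℓ F _ n (Units.map (Algebra.norm F : E →* F) x), toAdd_pow, map_nsmul,
    toZModPow_lAdicVal p ℓ E a n x hx, normalizedVal_norm, toAdd_pow]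
  · simp
  · show _ = levelMap ℓ _ n (a.1 n)
    rw [← hx]
    rfl

theorem range_lAdicVal_comp_lAdicNorm :
    ((lAdicVal p F ℓ).comp (lAdicNorm ℓ F E)).range =
      (powMonoidHom (residueDegree p F E) :
        Multiplicative ℤ_[ℓ] →* Multiplicative ℤ_[ℓ]).range := by
  have h : (lAdicVal p F ℓ).comp (lAdicNorm ℓ F E) =
      (powMonoidHom (residueDegree p F E)).comp (lAdicVal p E ℓ) :=
    MonoidHom.ext fun a => lAdicVal_lAdicNorm p ℓ F E a
  rw [h, MonoidHom.range_comp, lAdicVal_range, ← MonoidHom.range_eq_map]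

end LAdicValuation

/-! ### Multiples of `ℤ_ℓ` -/

section PadicPowers

variable (ℓ : ℕ) [Fact ℓ.Prime]

theorem isUnit_natCast_padicInt {u : ℕ} (hu : ¬ ℓ ∣ u) : IsUnit (u : ℤ_[ℓ]) := by
  rw [PadicInt.isUnit_iff, PadicInt.norm_natCast_eq_one_iff]
  exact (Nat.Prime.coprime_iff_not_dvd Fact.out).2 hu

/-- The prime-to-`ℓ` part of `f` is a unit of `ℤ_ℓ`. This reconciles the residue degree, which can
be any positive integer, with the index of a degree image, which is a power of `ℓ`. -/
theorem range_powMonoidHom_eq {f : ℕ} (hf : f ≠ 0) :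
    (powMonoidHom f : Multiplicative ℤ_[ℓ] →* Multiplicative ℤ_[ℓ]).range =
      (powMonoidHom (ℓ ^ f.factorization ℓ) :
        Multiplicative ℤ_[ℓ] →* Multiplicative ℤ_[ℓ]).range := by
  have hℓ : ℓ.Prime := Fact.out
  obtain ⟨v, hv⟩ := isUnit_natCast_padicInt ℓ (Nat.not_dvd_ordCompl hℓ hf)
  have hfe : ℓ ^ f.factorization ℓ * (f / ℓ ^ f.factorization ℓ) = f :=
    Nat.ordProj_mul_ordCompl_eq_self f ℓ
  refine le_antisymm ?_ ?_
  · rintro _ ⟨x, rfl⟩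
    refine ⟨x ^ (f / ℓ ^ f.factorization ℓ), ?_⟩
    rw [powMonoidHom_apply, powMonoidHom_apply, ← pow_mul, mul_comm, hfe]
  · rintro _ ⟨x, rfl⟩
    refine ⟨Multiplicative.ofAdd ((↑v⁻¹ : ℤ_[ℓ]) * Multiplicative.toAdd x), ?_⟩
    apply Multiplicative.toAdd.injective
    rw [powMonoidHom_apply, powMonoidHom_apply, toAdd_pow, toAdd_pow, toAdd_ofAdd,
      nsmul_eq_mul, nsmul_eq_mul]
    conv_lhs => rw [← hfe, Nat.cast_mul, ← hv]
    rw [mul_assoc, Units.mul_inv_cancel_left]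

theorem nonempty_quotient_mulEquiv (Z : Subgroup (Multiplicative ℤ_[ℓ])) (hZ : Z = ⊤) (m : ℕ) :
    Nonempty ((Z ⧸ (powMonoidHom (ℓ ^ m) : Z →* Z).range) ≃* Multiplicative (ZMod (ℓ ^ m))) := by
  let φ : Z →* Multiplicative (ZMod (ℓ ^ m)) :=
    (AddMonoidHom.toMultiplicative (PadicInt.toZModPow m : ℤ_[ℓ] →+* ZMod (ℓ ^ m)).toAddMonoidHom).comp
      Z.subtype
  have hφ : Function.Surjective φ := by
    intro y
    obtain ⟨x, hx⟩ := ZMod.ringHom_surjective (PadicInt.toZModPow m : ℤ_[ℓ] →+* ZMod (ℓ ^ m))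
      (Multiplicative.toAdd y)
    exact ⟨⟨Multiplicative.ofAdd x, by rw [hZ]; trivial⟩, congrArg Multiplicative.ofAdd hx⟩
  have hker : φ.ker = (powMonoidHom (ℓ ^ m) : Z →* Z).range := by
    ext ⟨x, hx⟩
    have h1 : (⟨x, hx⟩ : Z) ∈ φ.ker ↔ (Multiplicative.toAdd x : ℤ_[ℓ]) ∈
        RingHom.ker (PadicInt.toZModPow m : ℤ_[ℓ] →+* ZMod (ℓ ^ m)) := Iff.rfl
    rw [h1, PadicInt.ker_toZModPow, Ideal.mem_span_singleton]
    constructor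
    · rintro ⟨c, hc⟩
      refine ⟨⟨Multiplicative.ofAdd c, by rw [hZ]; trivial⟩, Subtype.ext ?_⟩
      apply Multiplicative.toAdd.injective
      rw [hc]
      show (ℓ ^ m) • c = _
      simp
    · rintro ⟨⟨c, _⟩, hc⟩
      refine ⟨Multiplicative.toAdd c, ?_⟩
      have h2 := congrArg (fun z : Z => Multiplicative.toAdd (z : Multiplicative ℤ_[ℓ])) hc
      refine h2.symm.trans ?_
      show (ℓ ^ m) • Multiplicative.toAdd c = _
      simp
  exact ⟨(QuotientGroup.quotientMulEquivOfEq hker.symm).trans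
    (QuotientGroup.quotientKerEquivOfSurjective φ hφ)⟩

end PadicPowers

/-! ### Construction of a degree map from the Frobenius action -/

section DegreeMap

open IntermediateField

variable (p ℓ : ℕ) [Fact p.Prime] (k : Type*) [Field k] [Algebra ℚ_[p] k] [FiniteDimensional ℚ_[p] k]

theorem maxProL_isGalois (p : ℕ) [Fact p.Prime] (ℓ : ℕ) (k : Type*) [Field k] [Algebra ℚ_[p] k] :
    IsGalois k (maxProL ℓ k) := by
  have := charZero_padic_algebra p k
  have h : ∀ E : {E | IsLExtension ℓ k E}, Normal k (E : IntermediateField k (AlgebraicClosure k)) :=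
    fun E => E.2.2.1.to_normal
  have : Normal k (maxProL ℓ k) := by
    rw [maxProL, sSup_eq_iSup']
    infer_instance
  exact ⟨⟩

theorem mem_galSubgroup_iff (ℓ : ℕ) {k : Type*} [Field k]
    {L : IntermediateField k (AlgebraicClosure k)}
    {σ : proLGaloisGroup ℓ k} :
    σ ∈ galSubgroup ℓ k L ↔ ∀ x : maxProL ℓ k, (x : AlgebraicClosure k) ∈ L → σ x = x :=
  mem_fixingSubgroup_iff _ _

variable {k} in
/-- `σ` acts on the roots of unity of order dividing `q ^ (ℓ ^ n) - 1` as the `a`-th power of the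
Frobenius. -/
def ActsAsFrobeniusPow (σ : proLGaloisGroup ℓ k) (n a : ℕ) : Prop :=
  ∀ x : maxProL ℓ k, x ^ (residueCard p k ^ ℓ ^ n - 1) = 1 → σ x = x ^ residueCard p k ^ a

variable {p ℓ k}

theorem ActsAsFrobeniusPow.mul {σ τ : proLGaloisGroup ℓ k} {n a b : ℕ}
    (hσ : ActsAsFrobeniusPow p ℓ σ n a) (hτ : ActsAsFrobeniusPow p ℓ τ n b) :
    ActsAsFrobeniusPow p ℓ (σ * τ) n (a + b) := by
  intro x hx
  rw [AlgEquiv.mul_apply, hτ x hx, map_pow, hσ x hx, ← pow_mul, pow_add]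

theorem ActsAsFrobeniusPow.of_succ {σ : proLGaloisGroup ℓ k} {n a : ℕ}
    (h : ActsAsFrobeniusPow p ℓ σ (n + 1) a) : ActsAsFrobeniusPow p ℓ σ n a := by
  intro x hx
  refine h x (orderOf_dvd_iff_pow_eq_one.1 ((orderOf_dvd_of_pow_eq_one hx).trans ?_))
  exact Nat.pow_sub_one_dvd_pow_sub_one _ (pow_dvd_pow ℓ n.le_succ)

variable (p ℓ k) [Fact ℓ.Prime]

theorem pow_ne_zero_of_prime (n : ℕ) : ℓ ^ n ≠ 0 := pow_ne_zero n (Nat.Prime.ne_zero Fact.out)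

theorem isLExtension_unramifiedExtension (n : ℕ) :
    IsLExtension ℓ k (unramifiedExtension p k (ℓ ^ n)) :=
  ⟨inferInstance, inferInstance, n, finrank_unramifiedExtension p k (pow_ne_zero_of_prime ℓ n)⟩

theorem isUnramified_unramifiedExtension {m : ℕ} (hm : m ≠ 0) :
    IsUnramified p k (unramifiedExtension p k m) := by
  rw [isUnramified_iff]
  exact (residueDegree_unramifiedExtension_and_finrank p k hm).1.trans
    (finrank_unramifiedExtension p k hm).symm

/-- An unramified extension is determined by its degree, so the unramified `ℓ`-extensions form a
single tower indexed by `n`. -/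
theorem maxUnramifiedProL_eq_iSup :
    maxUnramifiedProL p ℓ k = ⨆ n : ℕ, unramifiedExtension p k (ℓ ^ n) := by
  refine le_antisymm (sSup_le ?_) (iSup_le fun n => le_sSup ⟨isLExtension_unramifiedExtension p ℓ k n,
    inferInstance, isUnramified_unramifiedExtension p k (pow_ne_zero_of_prime ℓ n)⟩)
  rintro E ⟨⟨-, -, n, hn⟩, _, hE⟩
  rw [eq_unramifiedExtension p k E hE, hn]
  exact le_iSup (fun n => unramifiedExtension p k (ℓ ^ n)) n

theorem unramifiedExtension_le_maxProL (n : ℕ) :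
    unramifiedExtension p k (ℓ ^ n) ≤ maxProL ℓ k :=
  le_sSup (isLExtension_unramifiedExtension p ℓ k n)

theorem maxUnramifiedProL_le_maxProL : maxUnramifiedProL p ℓ k ≤ maxProL ℓ k := by
  rw [maxUnramifiedProL_eq_iSup]
  exact iSup_le fun n => unramifiedExtension_le_maxProL p ℓ k n

variable {k} in
theorem mem_maxProL_of_pow_eq_one (n : ℕ) {x : AlgebraicClosure k}
    (hx : x ^ (residueCard p k ^ ℓ ^ n - 1) = 1) : x ∈ maxProL ℓ k :=
  unramifiedExtension_le_maxProL p ℓ k n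
    (mem_unramifiedExtension p (pow_ne_zero_of_prime ℓ n) hx)

variable {k}

theorem exists_actsAsFrobeniusPow (σ : proLGaloisGroup ℓ k) (n : ℕ) :
    ∃ a, ActsAsFrobeniusPow p ℓ σ n a := by
  have := maxProL_isGalois p ℓ k
  obtain ⟨a, ha⟩ := exists_algEquiv_pow p k (σ.liftNormal (AlgebraicClosure k))
    (pow_ne_zero_of_prime ℓ n)
  refine ⟨a, fun x hx => Subtype.ext ?_⟩
  exact (σ.liftNormal_commutes (AlgebraicClosure k) x).symm.trans (ha x (congrArg Subtype.val hx))

variable {p ℓ}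

theorem ActsAsFrobeniusPow.modEq {σ : proLGaloisGroup ℓ k} {n a b : ℕ}
    (ha : ActsAsFrobeniusPow p ℓ σ n a) (hb : ActsAsFrobeniusPow p ℓ σ n b) :
    a ≡ b [MOD ℓ ^ n] := by
  have hn := pow_ne_zero_of_prime ℓ n
  obtain ⟨ζ, hζ⟩ := exists_isPrimitiveRoot_algebraicClosure p k hn
  have hmem := mem_maxProL_of_pow_eq_one p ℓ n hζ.pow_eq_one
  have h1 : (⟨ζ, hmem⟩ : maxProL ℓ k) ^ (residueCard p k ^ ℓ ^ n - 1) = 1 :=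
    Subtype.ext hζ.pow_eq_one
  exact (pow_eq_pow_iff_modEq p hn hζ).1 (congrArg Subtype.val ((ha _ h1).symm.trans (hb _ h1)))

theorem ActsAsFrobeniusPow.of_modEq {σ : proLGaloisGroup ℓ k} {n a b : ℕ}
    (ha : ActsAsFrobeniusPow p ℓ σ n a) (hab : a ≡ b [MOD ℓ ^ n]) :
    ActsAsFrobeniusPow p ℓ σ n b := by
  have hn := pow_ne_zero_of_prime ℓ n
  obtain ⟨ζ, hζ⟩ := exists_isPrimitiveRoot_algebraicClosure p k hn
  have : NeZero (residueCard p k ^ ℓ ^ n - 1) := ⟨residueCard_pow_sub_one_ne_zero p k hn⟩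
  intro x hx
  rw [ha x hx]
  apply Subtype.ext
  obtain ⟨i, -, hi⟩ := hζ.eq_pow_of_pow_eq_one (congrArg Subtype.val hx)
  show (x : AlgebraicClosure k) ^ _ = (x : AlgebraicClosure k) ^ _
  rw [← hi, ← pow_mul, mul_comm, pow_mul, (pow_eq_pow_iff_modEq p hn hζ).2 hab, ← pow_mul,
    mul_comm, pow_mul]

variable (p) in
/-- The exponent of the power of Frobenius by which `σ` acts. -/
def frobeniusExponent (σ : proLGaloisGroup ℓ k) (n : ℕ) : ℤ :=
  ((exists_actsAsFrobeniusPow p ℓ σ n).choose : ℕ)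

theorem frobeniusExponent_dvd (σ : proLGaloisGroup ℓ k) (n : ℕ) :
    (ℓ : ℤ) ^ n ∣ frobeniusExponent p σ (n + 1) - frobeniusExponent p σ n := by
  have h := (exists_actsAsFrobeniusPow p ℓ σ n).choose_spec.modEq
    (exists_actsAsFrobeniusPow p ℓ σ (n + 1)).choose_spec.of_succ
  have h' := Nat.modEq_iff_dvd.1 h
  rw [Nat.cast_pow] at h'
  exact h'

variable (p) in
/-- The element `d` of `ℤ_ℓ` such that `σ` acts on the maximal unramified pro-`ℓ`-extension as the
`d`-th power of the Frobenius. -/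
def frobeniusDegree (σ : proLGaloisGroup ℓ k) : ℤ_[ℓ] :=
  PadicInt.ofIntSeq (frobeniusExponent p σ)
    (PadicInt.isCauSeq_padicNorm_of_pow_dvd_sub _ ℓ (frobeniusExponent_dvd σ))

theorem ActsAsFrobeniusPow.toZModPow_frobeniusDegree {σ : proLGaloisGroup ℓ k} {n a : ℕ}
    (h : ActsAsFrobeniusPow p ℓ σ n a) : (frobeniusDegree p σ).toZModPow n = a := by
  rw [frobeniusDegree, PadicInt.toZModPow_ofIntSeq_of_pow_dvd_sub _ _ (frobeniusExponent_dvd σ),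
    frobeniusExponent, Int.cast_natCast, ZMod.natCast_eq_natCast_iff]
  exact (exists_actsAsFrobeniusPow p ℓ σ n).choose_spec.modEq h

theorem toZModPow_frobeniusDegree_iff {σ : proLGaloisGroup ℓ k} {n a : ℕ} :
    (frobeniusDegree p σ).toZModPow n = a ↔ ActsAsFrobeniusPow p ℓ σ n a := by
  refine ⟨fun h => ?_, fun h => h.toZModPow_frobeniusDegree⟩
  obtain ⟨b, hb⟩ := exists_actsAsFrobeniusPow p ℓ σ n
  rw [hb.toZModPow_frobeniusDegree, ZMod.natCast_eq_natCast_iff] at h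
  exact hb.of_modEq h

theorem actsAsFrobeniusPow_zero_iff {σ : proLGaloisGroup ℓ k} {n : ℕ} :
    ActsAsFrobeniusPow p ℓ σ n 0 ↔ ∀ x : maxProL ℓ k,
      (x : AlgebraicClosure k) ∈ unramifiedExtension p k (ℓ ^ n) → σ x = x := by
  have hn := pow_ne_zero_of_prime ℓ n
  constructor
  · intro h
    have := maxProL_isGalois p ℓ k
    -- Fixing the generating roots of unity suffices. The fixed field is taken for a lift of `σ` to
    -- the algebraic closure, so that it can be compared there with the unramified extension.
    have hle : unramifiedExtension p k (ℓ ^ n) ≤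
        fixedField (Subgroup.zpowers (σ.liftNormal (AlgebraicClosure k))) := by
      refine unramifiedExtension_le p k hn fun x hx => ?_
      have h1 : σ.liftNormal (AlgebraicClosure k) x = x := by
        refine (σ.liftNormal_commutes (AlgebraicClosure k)
          ⟨x, mem_maxProL_of_pow_eq_one p ℓ n hx⟩).trans ?_
        rw [h _ (Subtype.ext hx), pow_zero, pow_one]
        rfl
      rw [mem_fixedField_iff]
      intro f hf
      have h2 : Subgroup.zpowers (σ.liftNormal (AlgebraicClosure k)) ≤
          MulAction.stabilizer (AlgebraicClosure k ≃ₐ[k] AlgebraicClosure k) x :=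
        Subgroup.zpowers_le.2 h1
      exact h2 hf
    intro x hx
    have h3 := (mem_fixedField_iff _ _).1 (hle hx) _ (Subgroup.mem_zpowers _)
    exact Subtype.ext ((σ.liftNormal_commutes (AlgebraicClosure k) x).symm.trans h3)
  · intro h x hx
    rw [h x (mem_unramifiedExtension p hn (congrArg Subtype.val hx)), pow_zero, pow_one]

theorem frobeniusDegree_mul (σ τ : proLGaloisGroup ℓ k) :
    frobeniusDegree p (σ * τ) = frobeniusDegree p σ + frobeniusDegree p τ := by
  refine PadicInt.ext_of_toZModPow.1 fun n => ?_
  obtain ⟨a, ha⟩ := exists_actsAsFrobeniusPow p ℓ σ n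
  obtain ⟨b, hb⟩ := exists_actsAsFrobeniusPow p ℓ τ n
  rw [(ha.mul hb).toZModPow_frobeniusDegree, map_add, ha.toZModPow_frobeniusDegree,
    hb.toZModPow_frobeniusDegree, Nat.cast_add]

theorem comap_map_val {K Ω : Type*} [Field K] [Field Ω] [Algebra K Ω]
    (L M : IntermediateField K Ω) : (L.comap M.val).map M.val = L ⊓ M := by
  ext x
  simp only [mem_map, mem_inf]
  constructor
  · rintro ⟨y, hy, rfl⟩
    exact ⟨hy, y.2⟩
  · rintro ⟨hL, hM⟩
    exact ⟨⟨x, hM⟩, hL, rfl⟩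

theorem finrank_comap_val {K Ω : Type*} [Field K] [Field Ω] [Algebra K Ω]
    (L M : IntermediateField K Ω) :
    Module.finrank K (L.comap M.val) = Module.finrank K (L ⊓ M : IntermediateField K Ω) := by
  rw [← comap_map_val]
  exact (equivMap (L.comap M.val) M.val).toLinearEquiv.finrank_eq

theorem finiteDimensional_comap_val {K Ω : Type*} [Field K] [Field Ω] [Algebra K Ω]
    (L M : IntermediateField K Ω) [FiniteDimensional K L] :
    FiniteDimensional K (L.comap M.val) := by
  have : FiniteDimensional K (L ⊓ M : IntermediateField K Ω) :=
    FiniteDimensional.of_injective (inclusion (inf_le_left : L ⊓ M ≤ L)).toLinearMap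
      (inclusion_injective inf_le_left)
  rw [← comap_map_val] at this
  exact (equivMap (L.comap M.val) M.val).symm.toLinearEquiv.finiteDimensional

theorem dist_le_of_toZModPow_eq {x y : ℤ_[ℓ]} {n : ℕ} (h : x.toZModPow n = y.toZModPow n) :
    dist x y ≤ (ℓ : ℝ) ^ (-n : ℤ) := by
  rw [dist_eq_norm, PadicInt.norm_le_pow_iff_mem_span_pow, ← PadicInt.ker_toZModPow,
    RingHom.mem_ker, map_sub, h, sub_self]

theorem exists_zpow_lt {ε : ℝ} (hε : 0 < ε) : ∃ n : ℕ, (ℓ : ℝ) ^ (-n : ℤ) < ε := by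
  have h1 : (1 : ℝ) < ℓ := by exact_mod_cast (Fact.out : ℓ.Prime).one_lt
  obtain ⟨n, hn⟩ := exists_pow_lt_of_lt_one hε (inv_lt_one_of_one_lt₀ h1)
  exact ⟨n, by rwa [zpow_neg, zpow_natCast, ← inv_pow]⟩

variable (p ℓ k)

/-- The degree map given by the action on roots of unity. -/
def frobeniusDegreeHom : proLGaloisGroup ℓ k →ₜ* Multiplicative ℤ_[ℓ] where
  toMonoidHom := MonoidHom.mk' (fun σ => Multiplicative.ofAdd (frobeniusDegree p σ)) fun σ τ => by
    rw [frobeniusDegree_mul, ofAdd_add]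
  continuous_toFun := by
    refine continuous_of_continuousAt_one (MonoidHom.mk' _ _) ?_
    show Filter.Tendsto (fun σ : proLGaloisGroup ℓ k => frobeniusDegree p σ) (nhds 1)
      (nhds (frobeniusDegree p 1))
    rw [Metric.tendsto_nhds]
    intro ε hε
    obtain ⟨n, hn⟩ := exists_zpow_lt (ℓ := ℓ) hε
    have := finiteDimensional_comap_val (unramifiedExtension p k (ℓ ^ n)) (maxProL ℓ k)
    -- The subgroup fixing the `n`-th layer is open, since the layer is finite over `k`, and the
    -- degree vanishes modulo `ℓ ^ n` on it.
    filter_upwards [((unramifiedExtension p k (ℓ ^ n)).comap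
      (maxProL ℓ k).val).fixingSubgroup_isOpen.mem_nhds (one_mem _)] with σ hσ
    refine (dist_le_of_toZModPow_eq ?_).trans_lt hn
    rw [(actsAsFrobeniusPow_zero_iff.2 fun x hx => hσ ⟨x, hx⟩).toZModPow_frobeniusDegree,
      (actsAsFrobeniusPow_zero_iff.2 fun x hx => rfl).toZModPow_frobeniusDegree]

theorem exists_actsAsFrobeniusPow_eq (n a : ℕ) :
    ∃ σ : proLGaloisGroup ℓ k, ActsAsFrobeniusPow p ℓ σ n a := by
  have := maxProL_isGalois p ℓ k
  obtain ⟨τ, hτ⟩ := exists_algEquiv_eq_pow p k (pow_ne_zero_of_prime ℓ n) a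
  refine ⟨τ.restrictNormal (maxProL ℓ k), fun x hx => Subtype.ext ?_⟩
  exact (τ.restrictNormal_commutes (maxProL ℓ k) x).trans (hτ x (congrArg Subtype.val hx))

/-- The image is compact, hence closed, and it is dense because every class modulo `ℓ ^ n` is
attained. -/
theorem frobeniusDegreeHom_surjective : Function.Surjective (frobeniusDegreeHom p ℓ k) := by
  have := maxProL_isGalois p ℓ k
  have hc : IsClosed (Set.range fun σ : proLGaloisGroup ℓ k => frobeniusDegree p σ) :=
    (isCompact_range (frobeniusDegreeHom p ℓ k).continuous_toFun).isClosed
  intro z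
  have hz : Multiplicative.toAdd z ∈
      closure (Set.range fun σ : proLGaloisGroup ℓ k => frobeniusDegree p σ) := by
    rw [Metric.mem_closure_iff]
    intro ε hε
    obtain ⟨n, hn⟩ := exists_zpow_lt (ℓ := ℓ) hε
    obtain ⟨σ, hσ⟩ := exists_actsAsFrobeniusPow_eq p ℓ k n
      (((Multiplicative.toAdd z : ℤ_[ℓ]).toZModPow n).val)
    refine ⟨_, ⟨σ, rfl⟩, (dist_le_of_toZModPow_eq ?_).trans_lt hn⟩
    rw [hσ.toZModPow_frobeniusDegree]
    have : NeZero (ℓ ^ n) := ⟨pow_ne_zero_of_prime ℓ n⟩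
    exact (ZMod.natCast_zmod_val _).symm
  rw [hc.closure_eq] at hz
  obtain ⟨σ, hσ⟩ := hz
  exact ⟨σ, congrArg Multiplicative.ofAdd hσ⟩

theorem directed_unramifiedExtension :
    Directed (· ≤ ·) fun n : ℕ => unramifiedExtension p k (ℓ ^ n) :=
  Monotone.directed_le fun _ n h =>
    unramifiedExtension_mono p k (pow_ne_zero_of_prime ℓ n) (pow_dvd_pow ℓ h)

theorem mem_maxUnramifiedProL_iff {x : AlgebraicClosure k} :
    x ∈ maxUnramifiedProL p ℓ k ↔ ∃ n : ℕ, x ∈ unramifiedExtension p k (ℓ ^ n) := by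
  rw [maxUnramifiedProL_eq_iSup, ← SetLike.mem_coe,
    coe_iSup_of_directed (directed_unramifiedExtension p ℓ k), Set.mem_iUnion]
  rfl

/-- For the kernel: the degree is zero when it is zero modulo every `ℓ ^ n`, that is, when every
layer is fixed; the union of the layers is `k^nr`. -/
theorem isDegreeMap_frobeniusDegreeHom : IsDegreeMap p ℓ k (frobeniusDegreeHom p ℓ k) := by
  refine ⟨frobeniusDegreeHom_surjective p ℓ k, Subgroup.ext fun σ => ?_⟩
  have h1 : σ ∈ (frobeniusDegreeHom p ℓ k).toMonoidHom.ker ↔ frobeniusDegree p σ = 0 := Iff.rfl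
  rw [h1, mem_galSubgroup_iff, ← PadicInt.ext_of_toZModPow]
  have h2 : ∀ n, (frobeniusDegree p σ).toZModPow n = (0 : ℤ_[ℓ]).toZModPow n ↔
      ∀ x : maxProL ℓ k, (x : AlgebraicClosure k) ∈ unramifiedExtension p k (ℓ ^ n) → σ x = x := by
    intro n
    rw [← actsAsFrobeniusPow_zero_iff, ← toZModPow_frobeniusDegree_iff, map_zero, Nat.cast_zero]
  simp only [h2, mem_maxUnramifiedProL_iff]
  exact ⟨fun h x ⟨n, hx⟩ => h n x hx, fun h n x hx => h x ⟨n, hx⟩⟩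

end DegreeMap

/-! ### The index of a degree image and the residue degree -/

section InertiaIndex

open IntermediateField

/-- Normality makes the join a product of two compact subgroups, hence closed. By the infinite
Galois correspondence it is then determined by its fixed field, the intersection of the two fixed
fields. -/
theorem galSubgroup_sup (p : ℕ) [Fact p.Prime] (ℓ : ℕ) (k : Type*) [Field k] [Algebra ℚ_[p] k]
    (N L : IntermediateField k (AlgebraicClosure k))
    [hN : (galSubgroup ℓ k N).Normal] :
    galSubgroup ℓ k L ⊔ galSubgroup ℓ k N = galSubgroup ℓ k (L ⊓ N) := by
  have := maxProL_isGalois p ℓ k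
  have hcl : ∀ E : IntermediateField k (AlgebraicClosure k),
      IsClosed (galSubgroup ℓ k E : Set (proLGaloisGroup ℓ k)) :=
    fun E => InfiniteGalois.fixingSubgroup_isClosed _
  have hclosed : IsClosed ((galSubgroup ℓ k L ⊔ galSubgroup ℓ k N :
      Subgroup (proLGaloisGroup ℓ k)) : Set (proLGaloisGroup ℓ k)) := by
    rw [Subgroup.mul_normal]
    exact ((hcl L).isCompact.mul (hcl N).isCompact).isClosed
  have h := InfiniteGalois.fixingSubgroup_fixedField (⟨_, hclosed⟩ : ClosedSubgroup _)
  refine h.symm.trans ?_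
  show _ = ((L ⊓ N).comap (maxProL ℓ k).val).fixingSubgroup
  congr 1
  have hfix : ∀ E : IntermediateField k (AlgebraicClosure k),
      fixedField (galSubgroup ℓ k E) = E.comap (maxProL ℓ k).val :=
    fun E => InfiniteGalois.fixedField_fixingSubgroup _
  ext x
  have hx : ∀ E : IntermediateField k (AlgebraicClosure k),
      x ∈ E.comap (maxProL ℓ k).val ↔ galSubgroup ℓ k E ≤
        MulAction.stabilizer (proLGaloisGroup ℓ k) x := by
    intro E
    rw [← hfix, mem_fixedField_iff]
    rfl
  rw [mem_fixedField_iff]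
  have h1 : (∀ f ∈ (galSubgroup ℓ k L ⊔ galSubgroup ℓ k N : Subgroup (proLGaloisGroup ℓ k)),
      f x = x) ↔ galSubgroup ℓ k L ⊔ galSubgroup ℓ k N ≤
        MulAction.stabilizer (proLGaloisGroup ℓ k) x := Iff.rfl
  have h2 : x ∈ (L ⊓ N).comap (maxProL ℓ k).val ↔
      x ∈ L.comap (maxProL ℓ k).val ∧ x ∈ N.comap (maxProL ℓ k).val := Iff.rfl
  rw [h2, hx, hx, ← sup_le_iff]
  exact h1

variable (p : ℕ) [Fact p.Prime] (k : Type*) [Field k] [Algebra ℚ_[p] k] [FiniteDimensional ℚ_[p] k]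

/-- Residue degrees and degrees are both multiplicative in `k ⊆ M ⊆ N`, and at each step the former
is at most the latter; equality for the whole tower forces equality at the bottom. -/
theorem residueDegree_of_le {M N : IntermediateField k (AlgebraicClosure k)} (h : M ≤ N)
    [FiniteDimensional k M] [FiniteDimensional k N] :
    haveI := finiteDimensional_padic p k M
    haveI := finiteDimensional_padic p k N
    residueDegree p k M ∣ residueDegree p k N ∧
      (residueDegree p k N = Module.finrank k N → residueDegree p k M = Module.finrank k M) := by
  have := finiteDimensional_padic p k M
  have := finiteDimensional_padic p k N
  let : Algebra M N := (inclusion h).toAlgebra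
  have : IsScalarTower k M N := IsScalarTower.of_algebraMap_eq fun _ => rfl
  have : IsScalarTower ℚ_[p] M N := IsScalarTower.of_algebraMap_eq fun _ => rfl
  have : FiniteDimensional M N := FiniteDimensional.right k M N
  have : Module.Free M N := Module.Free.of_divisionRing M N
  have : Module.Free k M := Module.Free.of_divisionRing k M
  have hf := residueDegree_mul p k M N
  refine ⟨⟨_, hf.symm⟩, fun hN => ?_⟩
  have hn := Module.finrank_mul_finrank k M N
  have h1 := Nat.le_of_dvd Module.finrank_pos (residueDegree_dvd_finrank p k M)
  have h2 := Nat.le_of_dvd Module.finrank_pos (residueDegree_dvd_finrank p M N)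
  refine le_antisymm h1 (not_lt.1 fun hlt => ?_)
  have h4 : residueDegree p k M * residueDegree p M N <
      Module.finrank k M * Module.finrank M N := Nat.mul_lt_mul_of_lt_of_le hlt h2 Module.finrank_pos
  omega

variable (ℓ : ℕ) [Fact ℓ.Prime]

/-- A primitive element of `M` already lies in one layer of the tower. -/
theorem exists_le_unramifiedExtension (M : IntermediateField k (AlgebraicClosure k))
    [FiniteDimensional k M] (hM : M ≤ maxUnramifiedProL p ℓ k) :
    ∃ n : ℕ, M ≤ unramifiedExtension p k (ℓ ^ n) := by
  have := charZero_padic_algebra p k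
  obtain ⟨α, hα⟩ := Field.exists_primitive_element k M
  obtain ⟨n, hn⟩ := (mem_maxUnramifiedProL_iff p ℓ k).1 (hM α.2)
  refine ⟨n, ?_⟩
  have h := congrArg (IntermediateField.map M.val) hα
  rw [adjoin_map, Set.image_singleton, ← AlgHom.fieldRange_eq_map, fieldRange_val] at h
  rw [← h, adjoin_simple_le_iff]
  exact hn

/-- Upper bound: the intersection lies in one layer, so it is unramified of `ℓ`-power degree, and
this degree is its residue degree and divides that of `L`. Lower bound: the layer whose degree is
the `ℓ`-part of the residue degree of `L` lies in both `L` and `k^nr`. -/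
theorem finrank_inf_maxUnramifiedProL (L : IntermediateField k (AlgebraicClosure k))
    [FiniteDimensional k L] :
    haveI := finiteDimensional_padic p k L
    Module.finrank k (L ⊓ maxUnramifiedProL p ℓ k : IntermediateField k (AlgebraicClosure k)) =
      ℓ ^ (residueDegree p k L).factorization ℓ := by
  have := finiteDimensional_padic p k L
  have hℓ : ℓ.Prime := Fact.out
  set M : IntermediateField k (AlgebraicClosure k) := L ⊓ maxUnramifiedProL p ℓ k with hM
  have : FiniteDimensional k M :=
    FiniteDimensional.of_injective (inclusion (inf_le_left : M ≤ L)).toLinearMap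
      (inclusion_injective inf_le_left)
  have := finiteDimensional_padic p k M
  obtain ⟨n, hn⟩ := exists_le_unramifiedExtension p k ℓ M inf_le_right
  have hn0 := pow_ne_zero_of_prime ℓ n
  have hfM : residueDegree p k M = Module.finrank k M := (residueDegree_of_le p k hn).2
    ((isUnramified_iff p k _).1 (isUnramified_unramifiedExtension p k hn0))
  have hdvd : Module.finrank k M ∣ ℓ ^ n := by
    rw [← finrank_unramifiedExtension p k hn0]
    let : Algebra M (unramifiedExtension p k (ℓ ^ n)) := (inclusion hn).toAlgebra
    have : IsScalarTower k M (unramifiedExtension p k (ℓ ^ n)) :=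
      IsScalarTower.of_algebraMap_eq fun _ => rfl
    exact ⟨_, (Module.finrank_mul_finrank k M _).symm⟩
  obtain ⟨b, -, hb⟩ := (Nat.dvd_prime_pow hℓ).1 hdvd
  have hfL : residueDegree p k L ≠ 0 := (residueDegree_pos p k L).ne'
  have hle : b ≤ (residueDegree p k L).factorization ℓ := by
    rw [← hℓ.pow_dvd_iff_le_factorization hfL, ← hb, ← hfM]
    exact (residueDegree_of_le p k (inf_le_left : M ≤ L)).1
  refine le_antisymm (hb ▸ Nat.pow_le_pow_right hℓ.pos hle) ?_
  have ha := pow_ne_zero_of_prime ℓ ((residueDegree p k L).factorization ℓ)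
  have hWM : unramifiedExtension p k (ℓ ^ (residueDegree p k L).factorization ℓ) ≤ M := by
    refine le_inf (unramifiedExtension_le_of_dvd p k ha L (Nat.ordProj_dvd _ _)) ?_
    rw [maxUnramifiedProL_eq_iSup]
    exact le_iSup (fun n => unramifiedExtension p k (ℓ ^ n)) _
  rw [← finrank_unramifiedExtension p k ha]
  exact LinearMap.finrank_le_finrank_of_injective (f := (inclusion hWM).toLinearMap)
    (inclusion_injective hWM)

variable {p k ℓ}

/-- By surjectivity the index is that of `G_L · ker deg = G_{L ∩ k^nr}`. Only the kernel of `deg`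
enters, so the value is the same for every degree map. -/
theorem IsDegreeMap.index_map_galSubgroup {deg : proLGaloisGroup ℓ k →ₜ* Multiplicative ℤ_[ℓ]}
    (hdeg : IsDegreeMap p ℓ k deg) (L : IntermediateField k (AlgebraicClosure k))
    [FiniteDimensional k L] :
    haveI := finiteDimensional_padic p k L
    ((galSubgroup ℓ k L).map deg.toMonoidHom).index =
      ℓ ^ (residueDegree p k L).factorization ℓ := by
  have := maxProL_isGalois p ℓ k
  have hsurj : deg.toMonoidHom.range = ⊤ := MonoidHom.range_eq_top.2 hdeg.surjective
  have hnormal : (galSubgroup ℓ k (maxUnramifiedProL p ℓ k)).Normal := by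
    rw [← hdeg.ker_eq]
    infer_instance
  rw [Subgroup.index_map, hsurj, Subgroup.index_top, mul_one, hdeg.ker_eq,
    galSubgroup_sup p ℓ k, galSubgroup, ← finrank_eq_fixingSubgroup_index, finrank_comap_val,
    inf_assoc, inf_eq_left.2 (maxUnramifiedProL_le_maxProL p ℓ k), finrank_inf_maxUnramifiedProL]

/-- The relative index is the quotient of the two absolute ones, and the `ℓ`-part of an integer is
multiplicative. -/
theorem IsDegreeMap.inertiaDegree_eq {deg : proLGaloisGroup ℓ k →ₜ* Multiplicative ℤ_[ℓ]}
    (hdeg : IsDegreeMap p ℓ k deg) {K L : IntermediateField k (AlgebraicClosure k)} (h : K ≤ L)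
    [FiniteDimensional k K] [FiniteDimensional k L] {f : ℕ} (hf : f ≠ 0)
    (hKL : haveI := finiteDimensional_padic p k K; haveI := finiteDimensional_padic p k L
      residueDegree p k K * f = residueDegree p k L) :
    inertiaDegree deg K L = ℓ ^ f.factorization ℓ := by
  have := finiteDimensional_padic p k K
  have hle : (galSubgroup ℓ k L).map deg.toMonoidHom ≤ (galSubgroup ℓ k K).map deg.toMonoidHom :=
    Subgroup.map_mono fun σ hσ => (mem_galSubgroup_iff ℓ).2 fun x hx =>
      (mem_galSubgroup_iff ℓ).1 hσ x (h hx)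
  have hi := Subgroup.relIndex_mul_index hle
  rw [hdeg.index_map_galSubgroup, hdeg.index_map_galSubgroup, ← hKL,
    Nat.factorization_mul (residueDegree_pos p k K).ne' hf, Finsupp.add_apply, pow_add,
    mul_comm (ℓ ^ _)] at hi
  exact Nat.eq_of_mul_eq_mul_right (Nat.pos_of_ne_zero (pow_ne_zero_of_prime ℓ _)) hi

theorem IsDegreeMap.isHenselianValuation {deg : proLGaloisGroup ℓ k →ₜ* Multiplicative ℤ_[ℓ]}
    (hdeg : IsDegreeMap p ℓ k deg) : IsHenselianValuation deg (lAdicVal p k ℓ) where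
  int_mem n := by
    rw [lAdicVal_range]
    trivial
  quotient m := nonempty_quotient_mulEquiv ℓ _ (lAdicVal_range p ℓ k) m
  range_norm L hL := by
    have := finiteDimensional_padic p k L
    rw [range_lAdicVal_comp_lAdicNorm, hdeg.index_map_galSubgroup, lAdicVal_range,
      range_powMonoidHom_eq ℓ (residueDegree_pos p k L).ne', ← MonoidHom.range_eq_map]

theorem IsDegreeMap.range_lAdicVal_comp_lAdicNorm
    {deg : proLGaloisGroup ℓ k →ₜ* Multiplicative ℤ_[ℓ]} (hdeg : IsDegreeMap p ℓ k deg)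
    (K : IntermediateField k (AlgebraicClosure k)) [FiniteDimensional ℚ_[p] K]
    (L : IntermediateField K (AlgebraicClosure k)) [FiniteDimensional K L] :
    ((lAdicVal p K ℓ).comp (lAdicNorm ℓ K L)).range =
      (powMonoidHom (inertiaDegree deg K (L.restrictScalars k)) :
        Multiplicative ℤ_[ℓ] →* Multiplicative ℤ_[ℓ]).range := by
  have : FiniteDimensional k K := FiniteDimensional.right ℚ_[p] k K
  -- `L` is given over `K`, while indices are computed over `k`. Borrowing the `ℚ_p`-structure of
  -- `L.restrictScalars k` makes the two residue degrees over `k` definitionally equal.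
  let : Algebra ℚ_[p] L := inferInstanceAs (Algebra ℚ_[p] (L.restrictScalars k))
  have : IsScalarTower ℚ_[p] k L := inferInstanceAs (IsScalarTower ℚ_[p] k (L.restrictScalars k))
  have : IsScalarTower ℚ_[p] K L := IsScalarTower.of_algebraMap_eq fun _ => rfl
  have : FiniteDimensional ℚ_[p] L := FiniteDimensional.trans ℚ_[p] K L
  have : FiniteDimensional k L := FiniteDimensional.trans k K L
  have : FiniteDimensional k (L.restrictScalars k) := this
  have := finiteDimensional_padic p k (L.restrictScalars k)
  have hle : K ≤ L.restrictScalars k := fun x hx => L.algebraMap_mem ⟨x, hx⟩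
  have hres : residueDegree p k L = residueDegree p k (L.restrictScalars k) := rfl
  rw [LAdicCFT.range_lAdicVal_comp_lAdicNorm p ℓ K L,
    hdeg.inertiaDegree_eq hle (residueDegree_pos p K L).ne'
      ((residueDegree_mul p k K L).trans hres),
    range_powMonoidHom_eq ℓ (residueDegree_pos p K L).ne']

end InertiaIndex

end LAdicCFT

end

open LAdicCFT in
theorem proposition2p4p1 (p ℓ : ℕ) [Fact p.Prime] [Fact ℓ.Prime]
    (k : Type*) [Field k] [Algebra ℚ_[p] k] [FiniteDimensional ℚ_[p] k] :
    (∃ deg : proLGaloisGroup ℓ k →ₜ* Multiplicative ℤ_[ℓ], IsDegreeMap p ℓ k deg) ∧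
    ∀ deg : proLGaloisGroup ℓ k →ₜ* Multiplicative ℤ_[ℓ], IsDegreeMap p ℓ k deg →
      IsHenselianValuation deg (lAdicVal p k ℓ) ∧
      (lAdicVal p k ℓ).range = ⊤ ∧
      ∀ (K : IntermediateField k (AlgebraicClosure k)) [FiniteDimensional ℚ_[p] K],
        (lAdicVal p K ℓ).range = ⊤ ∧
        ∀ (L : IntermediateField K (AlgebraicClosure k)) [FiniteDimensional K L],
          ((lAdicVal p K ℓ).comp (lAdicNorm ℓ K L)).range =
            (powMonoidHom (inertiaDegree deg K (L.restrictScalars k)) :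
              Multiplicative ℤ_[ℓ] →* Multiplicative ℤ_[ℓ]).range :=
  ⟨⟨frobeniusDegreeHom p ℓ k, isDegreeMap_frobeniusDegreeHom p ℓ k⟩, fun _ hdeg =>
    ⟨hdeg.isHenselianValuation, lAdicVal_range p ℓ k, fun K _ =>
      ⟨lAdicVal_range p ℓ K, fun L _ => hdeg.range_lAdicVal_comp_lAdicNorm K L⟩⟩⟩
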